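/- Let $1/2<l<1$, let $h:\mathbb R^2\to\mathbb R$ be Lipschitz, $\Omega=\{x\in\mathbb R^3: x_3<h(x_1,x_2)\}$, and $Q_T=\Omega\times(0,T)$ for $0<T<\infty$. Let $E_1,E_2,E_3$ be finite-dimensional real normed spaces and let $(a,b)\mapsto ab$ be a bilinear product $E_1\times E_2\to E_3$ (for example the product of real numbers, or of matrices); $|\cdot|$ denotes the norms. For $0<\sigma<1$ and an open set $S\subset\mathbb R^n$ put $$[u]^2_{\sigma,S}=\int_S\int_S\frac{|u(x)-u(y)|^2}{|x-y|^{n+2\sigma}}\,dx\,dy,\qquad \|u\|^2_{W_2^\sigma(S)}=\|u\|^2_{L^2(S)}+[u]^2_{\sigma,S},$$ $$\|u\|^2_{W_2^{1+\sigma}(\Omega)}=\|u\|^2_{L^2(\Omega)}+\sum_{i=1}^3\|\partial_i u\|^2_{L^2(\Omega)}+\sum_{i=1}^3[\partial_i u]^2_{\sigma,\Omega},$$ with weak derivatives $\partial_i u$. For $s\in\{l,l+1\}$ put $$\|u\|^2_{W_2^{s,s/2}(Q_T)}=\int_0^T\|u(t,\cdot)\|^2_{W_2^s(\Omega)}\,dt+\int_\Omega\|u(\cdot,x)\|^2_{W_2^{s/2}(0,T)}\,dx,$$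 and let $$\big(\|u\|^{(l)}_{Q_T}\big)^2=\|u\|^2_{W_2^{l,l/2}(Q_T)}+T^{-l}\|u\|^2_{L^2(Q_T)},$$ $$\|u\|^2_{H^{l+1,(l+1)/2}(Q_T)}=\|u\|^2_{W_2^{l+1,(l+1)/2}(Q_T)}+\operatorname*{ess\,sup}_{0<t<T}\|u(t,\cdot)\|^2_{W_2^l(\Omega)}.$$ The space $H^{l+1,(l+1)/2}(Q_T)$ consists of the measurable functions on $Q_T$ for which the last norm is finite. **Proposition 5.1.** There is a nondecreasing function $C_{51}:(0,\infty)\to[0,\infty)$, depending only on $l$, $\Omega$ and the product $E_1\times E_2\to E_3$, such that for every $T>0$ and all $F,G\in H^{l+1,(l+1)/2}(Q_T)$, with values in $E_1$ and $E_2$ respectively, $$\|FG\|^{(l)}_{Q_T}\le C_{51}(T)\,\|F\|_{H^{l+1,(l+1)/2}(Q_T)}\,\|G\|_{H^{l+1,(l+1)/2}(Q_T)}.$$ -/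

import Mathlib

open MeasureTheory Set
open scoped ENNReal NNReal ContDiff

noncomputable section

/-- Three-dimensional Euclidean space. -/
abbrev R3 : Type := EuclideanSpace ℝ (Fin 3)

/-- The domain of infinite depth below the graph of `h : ℝ² → ℝ`:
all `x = (x₀, x₁, x₂)` with `x₂ < h (x₀, x₁)`. -/
def fluidDomain (h : EuclideanSpace ℝ (Fin 2) → ℝ) : Set R3 :=
  {x | x 2 < h !₂[x 0, x 1]}

section Norms

variable {V : Type*} [NormedAddCommGroup V] [NormedSpace ℝ V] [MeasureSpace V]
variable {E : Type*} [NormedAddCommGroup E] [NormedSpace ℝ E]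

/-- The squared `L²(S)` norm, with value `∞` when it is not finite. -/
def l2Sq (S : Set V) (u : V → E) : ℝ≥0∞ :=
  ∫⁻ x in S, ‖u x‖ₑ ^ 2

/-- The squared Slobodetskii seminorm of order `σ ∈ (0, 1)` on `S ⊆ V`, with `n = dim V`:
`∫_S ∫_S |u x - u y|² / |x - y| ^ (n + 2 σ) dy dx`. -/
def slobSeminormSq (σ : ℝ) (S : Set V) (u : V → E) : ℝ≥0∞ :=
  ∫⁻ x in S, ∫⁻ y in S, ‖u x - u y‖ₑ ^ 2 / ‖x - y‖ₑ ^ ((Module.finrank ℝ V : ℝ) + 2 * σ)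

/-- The squared norm of `W₂^σ(S)` for `0 < σ < 1`. -/
def slobSq (σ : ℝ) (S : Set V) (u : V → E) : ℝ≥0∞ :=
  l2Sq S u + slobSeminormSq σ S u

/-- `v` is the weak partial derivative of `u` in direction `i` on the open set `Ω`. -/
def HasWeakPartial (Ω : Set R3) (i : Fin 3) (u v : R3 → E) : Prop :=
  LocallyIntegrableOn u Ω ∧ LocallyIntegrableOn v Ω ∧
    ∀ φ : R3 → ℝ, ContDiff ℝ ∞ φ → HasCompactSupport φ → tsupport φ ⊆ Ω →
      ∫ x in Ω, fderiv ℝ φ x (EuclideanSpace.single i 1) • u x = - ∫ x in Ω, φ x • v x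

/-- The squared norm of `W₂^(1+σ)(Ω)` for `0 < σ < 1`. The weak gradient `v` is unique up to
null sets, so the infimum is the value at the weak gradient, and `∞` when there is none. -/
def slobOneSq (σ : ℝ) (Ω : Set R3) (u : R3 → E) : ℝ≥0∞ :=
  ⨅ (v : Fin 3 → R3 → E) (_ : ∀ i, HasWeakPartial Ω i u (v i)),
    l2Sq Ω u + ∑ i, l2Sq Ω (v i) + ∑ i, slobSeminormSq σ Ω (v i)

/-- The squared norm of `L²(Q_T)`, `Q_T = Ω × (0, T)`, for `u = u t x`. -/
def parL2Sq (T : ℝ) (Ω : Set R3) (u : ℝ → R3 → E) : ℝ≥0∞ :=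
  ∫⁻ t in Ioo 0 T, l2Sq Ω (u t)

/-- The squared norm of `W₂^{l, l/2}(Q_T)` for `0 < l < 1`. -/
def parSq (l T : ℝ) (Ω : Set R3) (u : ℝ → R3 → E) : ℝ≥0∞ :=
  (∫⁻ t in Ioo 0 T, slobSq l Ω (u t)) +
    ∫⁻ x in Ω, slobSq (l / 2) (Ioo 0 T) (fun t => u t x)

/-- The squared norm of `W₂^{l+1, (l+1)/2}(Q_T)` for `0 < l < 1`. -/
def parOneSq (l T : ℝ) (Ω : Set R3) (u : ℝ → R3 → E) : ℝ≥0∞ :=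
  (∫⁻ t in Ioo 0 T, slobOneSq l Ω (u t)) +
    ∫⁻ x in Ω, slobSq ((l + 1) / 2) (Ioo 0 T) (fun t => u t x)

/-- The norm `‖u‖^{(l)}_{Q_T}`, the square root of
`‖u‖²_{W₂^{l, l/2}(Q_T)} + T^{-l} ‖u‖²_{L²(Q_T)}`. -/
def normQ (l T : ℝ) (Ω : Set R3) (u : ℝ → R3 → E) : ℝ≥0∞ :=
  (parSq l T Ω u + ENNReal.ofReal (T ^ (-l)) * parL2Sq T Ω u) ^ (1 / 2 : ℝ)

/-- The norm of `H^{l+1, (l+1)/2}(Q_T)`, the square root of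
`‖u‖²_{W₂^{l+1, (l+1)/2}(Q_T)} + sup_{0 < t < T} ‖u(t)‖²_{W₂^l(Ω)}`.
The supremum is the essential one, so that the norm depends only on the a.e. class of `u`. -/
def normH (l T : ℝ) (Ω : Set R3) (u : ℝ → R3 → E) : ℝ≥0∞ :=
  (parOneSq l T Ω u +
    essSup (fun t => slobSq l Ω (u t)) (volume.restrict (Ioo 0 T))) ^ (1 / 2 : ℝ)

/-- Membership in `H^{l+1, (l+1)/2}(Q_T)`: measurable on `Q_T` with finite norm. -/
def MemH (l T : ℝ) (Ω : Set R3) (u : ℝ → R3 → E) : Prop :=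
  AEStronglyMeasurable (Function.uncurry u)
    ((volume.restrict (Ioo 0 T)).prod (volume.restrict Ω)) ∧
  normH l T Ω u < ⊤

end Norms

end

/-! The estimate needs three facts about one factor on `Ω`: it lies in `L^∞(Ω)` for almost every
time, with sup norm `M t` square integrable in time; it lies in `L^p(Ω)` uniformly in time; and its
time seminorm of order `(l + 1) / 2` is finite. They are collected in `ParabolicBound` and produced
by `exists_parabolicBound`.

The first two facts are Sobolev embeddings, proved directly on domains that contain a cone of balls
at each point, with no extension operator. For `W₂^σ ⊂ L^p` with `3/2 - 3/p ≤ σ`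
(`lintegral_rpow_le_slobSq`), a value `u x` is compared with the average over the cone ball of scale
`s`. Optimising in `s` (`hedberg_optimization`) and integrating gives `P^p ≤ C P^(p-2) ‖u‖²` with
`P` the `L^p` norm, from which `P^(p-2)` is cancelled. For `W₂^{1+σ} ⊂ L^∞` with `σ > 1/2`
(`essSup_sq_le_slobOneSq`), mollified values are followed along the cone. Their derivative in `s` is
at most `C s^(-3/p) ‖∇u‖_p`, integrable at `0` because `p > 3`.

For the product, the spatial seminorm is controlled by the sup norm of one factor times the seminorm
of the other (`lintegral_slobSeminormSq_mul_le`). The `L²` norm is controlled through `L⁴` norms, by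
interpolation between `L^p` and `L^∞`; this yields a factor `T^((p-2)/2)`, which beats the weight
`T^(-l)` when `p > 2 + 2l`. The time seminorm is the main point (`lintegral_time_difference_le`):
`|f(t)|² |g(t) - g(s)|²` is bounded by Hölder in `x`, interpolating the difference between `L²` and
`L^∞`; Hölder in `(t, s)` then leaves a kernel `|t - s|^(-κ)` with `κ < 1`, again when `p > 2 + 2l`.
Such a `p` is compatible with the Sobolev condition because `l > 1/2`. -/

/-! ### The cone property of the domain below a Lipschitz graph. -/

/-- `Ω` contains, with each of its points `x`, the infinite cone spanned from `x` by the
closed unit ball around `e`. -/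
def ContainsCone (Ω : Set R3) (e : R3) : Prop :=
  ∀ x ∈ Ω, ∀ s : ℝ, 0 < s → Metric.closedBall (x + s • e) s ⊆ Ω

lemma isOpen_fluidDomain {h : EuclideanSpace ℝ (Fin 2) → ℝ} (hh : Continuous h) :
    IsOpen (fluidDomain h) := by
  unfold fluidDomain
  refine isOpen_lt (by fun_prop) (hh.comp ?_)
  refine (PiLp.continuous_toLp 2 _).comp (continuous_pi fun i => ?_)
  fin_cases i
  · exact (by fun_prop : Continuous fun x : R3 => x 0)
  · exact (by fun_prop : Continuous fun x : R3 => x 1)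

/-- Within the ball the horizontal displacement is at most `s`, so `h` falls by at most `K * s`. The
centre lies `(K + 2) * s` below `x`, and the ball rises at most `s` above its centre, so it stays
below the graph. -/
lemma containsCone_fluidDomain {h : EuclideanSpace ℝ (Fin 2) → ℝ} {K : ℝ≥0}
    (hh : LipschitzWith K h) :
    ContainsCone (fluidDomain h) (EuclideanSpace.single 2 (-((K : ℝ) + 2))) := by
  intro x hx s hs y hy
  rw [Metric.mem_closedBall, EuclideanSpace.dist_eq, Real.sqrt_le_left hs.le,
    Fin.sum_univ_three] at hy
  simp only [PiLp.add_apply, PiLp.smul_apply, PiLp.single_apply, Real.dist_eq, sq_abs,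
    smul_eq_mul] at hy
  have h02 : (0 : Fin 3) ≠ 2 := by decide
  have h12 : (1 : Fin 3) ≠ 2 := by decide
  simp only [h02, h12, if_true, if_false, mul_zero, add_zero] at hy
  have h1 : dist (!₂[x 0, x 1] : EuclideanSpace ℝ (Fin 2)) !₂[y 0, y 1] ≤ s := by
    rw [EuclideanSpace.dist_eq, Real.sqrt_le_left hs.le, Fin.sum_univ_two]
    simp only [Real.dist_eq, sq_abs, Matrix.cons_val_zero, Matrix.cons_val_one]
    nlinarith [sq_nonneg (y 2 - (x 2 + s * -((K : ℝ) + 2)))]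
  have h2 := hh.dist_le_mul (!₂[x 0, x 1] : EuclideanSpace ℝ (Fin 2)) !₂[y 0, y 1]
  have h3 : y 2 - (x 2 + s * -((K : ℝ) + 2)) ≤ s := by
    refine abs_le_of_sq_le_sq' ?_ hs.le |>.2
    nlinarith [sq_nonneg (y 0 - x 0), sq_nonneg (y 1 - x 1)]
  have h4 := mul_le_mul_of_nonneg_left h1 K.coe_nonneg
  have h5 := (le_abs_self _).trans h2
  simp only [fluidDomain, mem_ofPred_eq] at hx ⊢
  nlinarith

/-! ### Fractional Sobolev embedding on domains with the cone property. -/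

lemma lintegral_le_measure_rpow_mul {α : Type*} [MeasurableSpace α] {μ : Measure α}
    {f : α → ℝ≥0∞} (hf : AEMeasurable f μ) {p : ℝ} (hp : 1 ≤ p) :
    ∫⁻ x, f x ∂μ ≤ μ univ ^ (1 - 1 / p) * (∫⁻ x, f x ^ p ∂μ) ^ (1 / p) := by
  have hp0 : 0 < p := by linarith
  have h1 : 1 / p ≤ 1 := by rw [div_le_one hp0]; exact hp
  have := ENNReal.lintegral_mul_norm_pow_le (μ := μ) (aemeasurable_const (b := (1 : ℝ≥0∞)))
    (hf.pow_const p) (p := 1 - 1 / p) (q := 1 / p) (by linarith) (by positivity) (by ring)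
  simpa [← ENNReal.rpow_mul, hp0.ne'] using this

section Sobolev

variable {E : Type*} [NormedAddCommGroup E]

/-- The inner integral in the Slobodetskii seminorm. -/
noncomputable def slobInner (σ : ℝ) (Ω : Set R3) (u : R3 → E) (x : R3) : ℝ≥0∞ :=
  ∫⁻ y in Ω, ‖u x - u y‖ₑ ^ 2 / ‖x - y‖ₑ ^ ((Module.finrank ℝ R3 : ℝ) + 2 * σ)

lemma ENNReal.le_mul_div_of_le {a c d : ℝ≥0∞} (hdc : d ≤ c) (hd : d ≠ ⊤) (h0 : d = 0 → a = 0) :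
    a ≤ c * (a / d) := by
  by_cases h : d = 0
  · simp [h0 h]
  · calc a = d * (a / d) := (ENNReal.mul_div_cancel h hd).symm
      _ ≤ _ := by gcongr

lemma finrank_R3 : (Module.finrank ℝ R3 : ℝ) = 3 := by simp

/-- Every point of the cone ball is within `(‖e‖ + 1) * s` of `x`, so the singular weight is bounded
below there by the corresponding negative power. -/
lemma lintegral_closedBall_le_slobInner {Ω : Set R3} {e : R3} (hΩ : ContainsCone Ω e) {σ : ℝ}
    (hσ : 0 < σ) (u : R3 → E) {x : R3} (hx : x ∈ Ω) {s : ℝ} (hs : 0 < s) :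
    ∫⁻ y in Metric.closedBall (x + s • e) s, ‖u x - u y‖ₑ ^ 2 ≤
      ENNReal.ofReal ((‖e‖ + 1) * s) ^ (3 + 2 * σ) * slobInner σ Ω u x := by
  have hc : ENNReal.ofReal ((‖e‖ + 1) * s) ^ (3 + 2 * σ) ≠ ⊤ :=
    ENNReal.rpow_ne_top_of_nonneg (by linarith) ENNReal.ofReal_ne_top
  rw [slobInner, ← lintegral_const_mul' _ _ hc, finrank_R3]
  calc _ ≤ ∫⁻ y in Metric.closedBall (x + s • e) s,
        ENNReal.ofReal ((‖e‖ + 1) * s) ^ (3 + 2 * σ) *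
          (‖u x - u y‖ₑ ^ 2 / ‖x - y‖ₑ ^ (3 + 2 * σ)) := by
        refine setLIntegral_mono' Metric.isClosed_closedBall.measurableSet fun y hy => ?_
        refine ENNReal.le_mul_div_of_le (ENNReal.rpow_le_rpow ?_ (by linarith))
          (ENNReal.rpow_ne_top_of_nonneg (by linarith) enorm_ne_top) ?_
        · rw [← ofReal_norm]
          refine ENNReal.ofReal_le_ofReal ?_
          rw [Metric.mem_closedBall, dist_comm, dist_eq_norm] at hy
          calc ‖x - y‖ = ‖(x + s • e - y) - s • e‖ := by congr 1; abel
            _ ≤ ‖x + s • e - y‖ + ‖s • e‖ := norm_sub_le _ _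
            _ ≤ s + s * ‖e‖ := by rw [norm_smul, Real.norm_of_nonneg hs.le]; gcongr
            _ = _ := by ring
        · intro h
          rw [ENNReal.rpow_eq_zero_iff_of_pos (by linarith), enorm_eq_zero, sub_eq_zero] at h
          simp [h]
    _ ≤ _ := lintegral_mono_set (hΩ x hx s hs)

/-- Averaging over balls in the cone. -/
lemma le_average_cone {Ω : Set R3} {e : R3} (hΩ : ContainsCone Ω e) {σ : ℝ}
    (hσ : 0 < σ) {p : ℝ} (hp : 1 ≤ p) {u : R3 → E} (hu : AEStronglyMeasurable u (volume.restrict Ω))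
    {v : R3 → ℝ≥0∞} (hv : AEMeasurable v (volume.restrict Ω))
    (huv : ∀ x y, v x ≤ v y + ‖u x - u y‖ₑ) {x : R3} (hx : x ∈ Ω) {s : ℝ} (hs : 0 < s) :
    v x ≤ (volume (Metric.ball (0 : R3) 1))⁻¹ ^ (1 / p) * ENNReal.ofReal s ^ (-(3 / p)) *
        (∫⁻ y in Ω, v y ^ p) ^ (1 / p) +
      (volume (Metric.ball (0 : R3) 1))⁻¹ ^ (1 / 2 : ℝ) *
        ENNReal.ofReal (‖e‖ + 1) ^ (3 / 2 + σ) * ENNReal.ofReal s ^ σ *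
        slobInner σ Ω u x ^ (1 / 2 : ℝ) := by
  set B := Metric.closedBall (x + s • e) s
  set b := volume (Metric.ball (0 : R3) 1)
  have hb0 : b ≠ 0 := (Metric.measure_ball_pos _ _ one_pos).ne'
  have hbt : b ≠ ⊤ := measure_ball_lt_top.ne
  set S := ENNReal.ofReal s
  have hS0 : S ≠ 0 := by simpa [S] using hs
  have hSt : S ≠ ⊤ := ENNReal.ofReal_ne_top
  have hBΩ : B ⊆ Ω := hΩ x hx s hs
  have hμB : volume B = S ^ (3 : ℝ) * b := by
    rw [Measure.addHaar_closedBall _ _ hs.le, ENNReal.ofReal_pow hs.le, ← ENNReal.rpow_natCast,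
      finrank_R3]
  have hB0 : volume B ≠ 0 := by
    rw [hμB]; exact mul_ne_zero (by simp [hS0]) hb0
  have hBt : volume B ≠ ⊤ := measure_closedBall_lt_top.ne
  have hvB : AEMeasurable v (volume.restrict B) := hv.mono_measure (Measure.restrict_mono hBΩ le_rfl)
  have huB : AEMeasurable (fun y => ‖u x - u y‖ₑ) (volume.restrict B) :=
    (aestronglyMeasurable_const.sub (hu.mono_measure (Measure.restrict_mono hBΩ le_rfl))).enorm
  -- The pointwise comparison is integrated in `y` over `B`; Hölder then treats the first term with
  -- exponent `p` and the second with exponent `2`.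
  have h1 : v x * volume B ≤ (∫⁻ y in B, v y) + ∫⁻ y in B, ‖u x - u y‖ₑ := by
    rw [← lintegral_add_left' hvB, ← setLIntegral_const]
    exact lintegral_mono fun y => huv x y
  have h2 : ∫⁻ y in B, v y ≤ volume B ^ (1 - 1 / p) * (∫⁻ y in Ω, v y ^ p) ^ (1 / p) := by
    refine (lintegral_le_measure_rpow_mul hvB hp).trans ?_
    rw [Measure.restrict_apply_univ]
    gcongr
  have h3 : ∫⁻ y in B, ‖u x - u y‖ₑ ≤ volume B ^ (1 - 1 / 2 : ℝ) *
      (ENNReal.ofReal ((‖e‖ + 1) * s) ^ (3 + 2 * σ) * slobInner σ Ω u x) ^ (1 / 2 : ℝ) := by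
    refine (lintegral_le_measure_rpow_mul huB one_le_two).trans ?_
    rw [Measure.restrict_apply_univ]
    gcongr
    simpa using lintegral_closedBall_le_slobInner hΩ hσ u hx hs
  have h4 : v x ≤ (volume B)⁻¹ ^ (1 / p) * (∫⁻ y in Ω, v y ^ p) ^ (1 / p) +
      (volume B)⁻¹ ^ (1 / 2 : ℝ) *
      (ENNReal.ofReal ((‖e‖ + 1) * s) ^ (3 + 2 * σ) * slobInner σ Ω u x) ^ (1 / 2 : ℝ) := by
    have key : ∀ q : ℝ, (volume B)⁻¹ ^ q = volume B ^ (1 - q) * (volume B)⁻¹ := by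
      intro q
      rw [ENNReal.inv_rpow, ← ENNReal.rpow_neg, ← ENNReal.rpow_neg_one,
        ← ENNReal.rpow_add _ _ hB0 hBt]
      ring_nf
    calc v x = v x * volume B * (volume B)⁻¹ := by
          rw [mul_assoc, ENNReal.mul_inv_cancel hB0 hBt, mul_one]
      _ ≤ _ := by
          rw [key, key]
          refine (mul_le_mul_left (h1.trans (add_le_add h2 h3)) _).trans_eq ?_
          ring
  refine h4.trans_eq ?_
  have hinv : (volume B)⁻¹ = S ^ (-3 : ℝ) * b⁻¹ := by
    rw [hμB, ENNReal.mul_inv (Or.inr hbt) (Or.inr hb0), ENNReal.rpow_neg]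
  have hSS : S ^ (-3 / 2 : ℝ) * S ^ (3 / 2 + σ) = S ^ σ := by
    rw [← ENNReal.rpow_add _ _ hS0 hSt]; ring_nf
  have hRs : ENNReal.ofReal ((‖e‖ + 1) * s) = ENNReal.ofReal (‖e‖ + 1) * S :=
    ENNReal.ofReal_mul (by positivity)
  rw [hinv, hRs, ENNReal.mul_rpow_of_nonneg _ _ (by positivity),
    ENNReal.mul_rpow_of_nonneg _ _ (by positivity), ENNReal.mul_rpow_of_nonneg _ _ (by positivity),
    ENNReal.mul_rpow_of_nonneg _ _ (by positivity), ENNReal.mul_rpow_of_nonneg _ _ (by positivity),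
    ← ENNReal.rpow_mul, ← ENNReal.rpow_mul,
    ← ENNReal.rpow_mul, ← ENNReal.rpow_mul, ← hSS]
  ring_nf

end Sobolev

lemma ENNReal.add_sq_le_two_mul (a b : ℝ≥0∞) : (a + b) ^ 2 ≤ 2 * (a ^ 2 + b ^ 2) := by
  have := ENNReal.rpow_add_le_mul_rpow_add_rpow a b (p := 2) one_le_two
  norm_num at this
  exact this

/-- Optimisation of the scale `s` in Hedberg's inequality. -/
lemma hedberg_optimization {p : ℝ} (hp : 2 < p) {v G P A : ℝ≥0∞} (hA : 1 ≤ A)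
    (hP0 : P ≠ 0) (hPt : P ≠ ⊤) (hvG : v ≤ G)
    (h : ∀ s : ℝ, 0 < s → v ≤ A * (ENNReal.ofReal s ^ (3 / 2 - 3 / p) * G +
      ENNReal.ofReal s ^ (-(3 / p)) * P)) :
    v ^ p ≤ (2 * A) ^ p * P ^ (p - 2) * G ^ 2 := by
  have hp0 : 0 < p := by linarith
  have hA0 : A ≠ 0 := (zero_lt_one.trans_le hA).ne'
  rcases eq_or_ne G 0 with hG0 | hG0
  · have : v = 0 := by simpa [hG0] using hvG
    simp [this, hp0]
  rcases eq_or_ne G ⊤ with hGt | hGt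
  · have h1 : (2 * A) ^ p * P ^ (p - 2) ≠ 0 := by
      refine mul_ne_zero ?_ ?_
      · simp [ENNReal.rpow_eq_zero_iff, hA0, hp0.not_gt]
      · simp [ENNReal.rpow_eq_zero_iff, hP0, hPt]
    rw [hGt, ENNReal.top_pow two_ne_zero, ENNReal.mul_top h1]
    exact le_top
  -- At this scale `S^(3/2) * G = P`, so the two terms coincide: both equal `P^(1 - 2/p) * G^(2/p)`.
  set S := (P * G⁻¹) ^ (2 / 3 : ℝ) with hS
  have hGi0 : G⁻¹ ≠ 0 := ENNReal.inv_ne_zero.2 hGt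
  have hGit : G⁻¹ ≠ ⊤ := ENNReal.inv_ne_top.2 hG0
  have hSt : S ≠ ⊤ := ENNReal.rpow_ne_top_of_nonneg (by norm_num) (ENNReal.mul_ne_top hPt hGit)
  have hS0 : S ≠ 0 := by
    simp only [hS, ne_eq, ENNReal.rpow_eq_zero_iff, mul_eq_zero, hP0, hGi0]
    norm_num
  have h1 := h S.toReal (ENNReal.toReal_pos hS0 hSt)
  rw [ENNReal.ofReal_toReal hSt, hS, ← ENNReal.rpow_mul, ← ENNReal.rpow_mul,
    ENNReal.mul_rpow_of_ne_zero hP0 hGi0, ENNReal.mul_rpow_of_ne_zero hP0 hGi0,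
    ENNReal.inv_rpow, ENNReal.inv_rpow, ← ENNReal.rpow_neg, ← ENNReal.rpow_neg] at h1
  have h2 : P ^ (2 / 3 * (3 / 2 - 3 / p)) * G ^ (-(2 / 3 * (3 / 2 - 3 / p))) * G =
      P ^ (1 - 2 / p) * G ^ (2 / p) := by
    conv_lhs => rw [mul_assoc]; rhs; rhs; rw [← ENNReal.rpow_one G]
    rw [← ENNReal.rpow_add _ _ hG0 hGt]
    congr 2 <;> ring
  have h3 : P ^ (2 / 3 * -(3 / p)) * G ^ (-(2 / 3 * -(3 / p))) * P =
      P ^ (1 - 2 / p) * G ^ (2 / p) := by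
    conv_lhs => rw [mul_right_comm]; lhs; rhs; rw [← ENNReal.rpow_one P]
    rw [← ENNReal.rpow_add _ _ hP0 hPt]
    congr 2 <;> ring
  rw [h2, h3] at h1
  calc v ^ p ≤ (2 * A * (P ^ (1 - 2 / p) * G ^ (2 / p))) ^ p := by
        refine ENNReal.rpow_le_rpow (h1.trans_eq ?_) hp0.le
        ring
    _ = _ := by
        rw [ENNReal.mul_rpow_of_nonneg (2 * A) _ hp0.le,
          ENNReal.mul_rpow_of_nonneg (P ^ _) _ hp0.le, ← ENNReal.rpow_mul, ← ENNReal.rpow_mul, mul_assoc, ← ENNReal.rpow_natCast]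
        congr 3
        · field_simp
        · field_simp; simp

section Sobolev

variable {E : Type*} [NormedAddCommGroup E]

/-- Fractional Sobolev embedding for a bounded minorant `v` of `‖u‖`. -/
lemma lintegral_rpow_le_of_bounded {Ω : Set R3} (hΩm : MeasurableSet Ω) {e : R3}
    (hΩ : ContainsCone Ω e) {σ : ℝ} (hσ : 0 < σ) {p : ℝ} (hp : 2 < p) (hpσ : 3 / 2 - 3 / p ≤ σ) :
    ∃ C : ℝ≥0, ∀ u : R3 → E, AEStronglyMeasurable u (volume.restrict Ω) →
      ∀ v : R3 → ℝ≥0∞, AEMeasurable v (volume.restrict Ω) →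
      (∀ x y, v x ≤ v y + ‖u x - u y‖ₑ) → (∀ x, v x ≤ ‖u x‖ₑ) →
      (∫⁻ x in Ω, v x ^ p ≠ ⊤) →
      (∫⁻ x in Ω, v x ^ p) ^ (2 / p) ≤
        C * ((∫⁻ x in Ω, ‖u x‖ₑ ^ 2) + ∫⁻ x in Ω, slobInner σ Ω u x) := by
  have hp0 : 0 < p := by linarith
  set b := volume (Metric.ball (0 : R3) 1)
  have hb0 : b ≠ 0 := (Metric.measure_ball_pos _ _ one_pos).ne'
  have hbt : b⁻¹ ≠ ⊤ := ENNReal.inv_ne_top.2 hb0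
  set c₁ := b⁻¹ ^ (1 / p)
  set c₂ := b⁻¹ ^ (1 / 2 : ℝ) * ENNReal.ofReal (‖e‖ + 1) ^ (3 / 2 + σ)
  have hc₁ : c₁ ≠ ⊤ := ENNReal.rpow_ne_top_of_nonneg (by positivity) hbt
  have hc₂ : c₂ ≠ ⊤ := ENNReal.mul_ne_top (ENNReal.rpow_ne_top_of_nonneg (by positivity) hbt)
    (ENNReal.rpow_ne_top_of_nonneg (by positivity) ENNReal.ofReal_ne_top)
  set A := c₁ + c₂ + 1
  have hAt : (2 * A) ^ p * 2 ≠ ⊤ := by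
    refine ENNReal.mul_ne_top (ENNReal.rpow_ne_top_of_nonneg hp0.le ?_) (by simp)
    simp [A, ENNReal.mul_eq_top, hc₁, hc₂]
  refine ⟨((2 * A) ^ p * 2).toNNReal, fun u hu v hv huv hvu hfin => ?_⟩
  rw [ENNReal.coe_toNNReal hAt]
  set P := (∫⁻ x in Ω, v x ^ p) ^ (1 / p) with hPdef
  rcases eq_or_ne P 0 with hP0 | hP0
  · have : ∫⁻ x in Ω, v x ^ p = 0 := by
      rw [hPdef, ENNReal.rpow_eq_zero_iff_of_pos (by positivity)] at hP0
      exact hP0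
    rw [this, ENNReal.zero_rpow_of_pos (by positivity)]
    exact zero_le
  have hPt : P ≠ ⊤ := ENNReal.rpow_ne_top_of_nonneg (by positivity) hfin
  -- Adding `v x` makes the bound trivial for `s ≥ 1`. Averaging is then needed only for `s ≤ 1`,
  -- where `s^σ ≤ s^(3/2 - 3/p)`, so an inequality between the exponents suffices.
  set G : R3 → ℝ≥0∞ := fun x => slobInner σ Ω u x ^ (1 / 2 : ℝ) + v x
  have hpt : ∀ x ∈ Ω, v x ^ p ≤ (2 * A) ^ p * P ^ (p - 2) * G x ^ 2 := by
    intro x hx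
    refine hedberg_optimization hp le_add_self hP0 hPt le_add_self fun s hs => ?_
    rcases le_total s 1 with h1 | h1
    · refine (le_average_cone hΩ hσ (by linarith : (1 : ℝ) ≤ p) hu hv huv hx hs).trans ?_
      have hS : ENNReal.ofReal s ^ σ ≤ ENNReal.ofReal s ^ (3 / 2 - 3 / p) :=
        ENNReal.rpow_le_rpow_of_exponent_ge (by simpa using h1) hpσ
      have e1 : c₁ ≤ A := by simp only [A, add_assoc]; exact le_self_add
      have e2 : c₂ ≤ A := by simp only [A]; rw [add_comm c₁ c₂, add_assoc]; exact le_self_add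
      rw [mul_add, add_comm]
      refine add_le_add ?_ ?_
      · rw [mul_assoc]
        exact mul_le_mul' e2 (mul_le_mul' hS le_self_add)
      · rw [mul_assoc]
        exact mul_le_mul' e1 le_rfl
    · have hS : (1 : ℝ≥0∞) ≤ ENNReal.ofReal s ^ (3 / 2 - 3 / p) := by
        refine ENNReal.one_le_rpow (by simpa using h1) ?_
        rw [sub_pos, div_lt_div_iff₀ hp0 two_pos]; linarith
      calc v x ≤ 1 * (1 * G x + 0) := by simp only [one_mul, add_zero]; exact le_add_self
        _ ≤ _ := by gcongr; exacts [le_add_self, zero_le]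
  have h1 : ∫⁻ x in Ω, v x ^ p ≤ (2 * A) ^ p * P ^ (p - 2) * (2 *
      ((∫⁻ x in Ω, ‖u x‖ₑ ^ 2) + ∫⁻ x in Ω, slobInner σ Ω u x)) := by
    refine (setLIntegral_mono' hΩm hpt).trans ?_
    rw [lintegral_const_mul' _ _ (ENNReal.mul_ne_top (ENNReal.rpow_ne_top_of_nonneg hp0.le
      (by simp [A, ENNReal.mul_eq_top, hc₁, hc₂])) (ENNReal.rpow_ne_top_of_nonneg (by linarith) hPt))]
    gcongr
    rw [add_comm, ← lintegral_add_right' _ (hu.enorm.pow_const 2),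
      ← lintegral_const_mul' _ _ (by simp)]
    refine lintegral_mono fun x => (ENNReal.add_sq_le_two_mul _ _).trans ?_
    have : (slobInner σ Ω u x ^ (1 / 2 : ℝ)) ^ 2 = slobInner σ Ω u x := by
      rw [← ENNReal.rpow_natCast, ← ENNReal.rpow_mul]; simp
    rw [this]
    gcongr
    exact hvu x
  have hPp : ∫⁻ x in Ω, v x ^ p = P ^ (p - 2) * P ^ (2 : ℝ) := by
    rw [← ENNReal.rpow_add _ _ hP0 hPt, hPdef, ← ENNReal.rpow_mul]
    simp [hp0.ne']
  have hP2 : (∫⁻ x in Ω, v x ^ p) ^ (2 / p) = P ^ (2 : ℝ) := by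
    rw [hPdef, ← ENNReal.rpow_mul]; ring_nf
  have hq0 : P ^ (p - 2) ≠ 0 := by simp [ENNReal.rpow_eq_zero_iff, hP0, hPt]
  have hqt : P ^ (p - 2) ≠ ⊤ := ENNReal.rpow_ne_top_of_nonneg (by linarith) hPt
  -- Absorption: the factor `P ^ (p - 2)` occurs on both sides and cancels, which requires `0 < P <
  -- ∞`.
  rw [hP2, ← ENNReal.mul_le_mul_iff_right hq0 hqt, ← hPp]
  refine h1.trans_eq ?_
  ring

/-- Fractional Sobolev embedding `W₂^σ(Ω) ⊂ L^p(Ω)` on domains with the cone property. -/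
theorem lintegral_rpow_le_slobSq [NormedSpace ℝ E] {Ω : Set R3} (hΩm : MeasurableSet Ω) {e : R3}
    (hΩ : ContainsCone Ω e) {σ : ℝ} (hσ : 0 < σ) {p : ℝ} (hp : 2 < p) (hpσ : 3 / 2 - 3 / p ≤ σ) :
    ∃ C : ℝ≥0, ∀ u : R3 → E, AEStronglyMeasurable u (volume.restrict Ω) →
      (∫⁻ x in Ω, ‖u x‖ₑ ^ p) ^ (2 / p) ≤ C * slobSq σ Ω u := by
  have hp0 : 0 < p := by linarith
  obtain ⟨C, hC⟩ := lintegral_rpow_le_of_bounded (E := E) hΩm hΩ hσ hp hpσ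
  -- The added `1` keeps the constant nonzero, so that its product with an infinite norm is
  -- infinite.
  refine ⟨C + 1, fun u hu => ?_⟩
  rcases eq_or_ne (slobSq σ Ω u) ⊤ with ht | ht
  · rw [ht, ENNReal.mul_top (by simp)]; exact le_top
  have hl2 : ∫⁻ x in Ω, ‖u x‖ₑ ^ 2 ≠ ⊤ := ne_top_of_le_ne_top ht le_self_add
  -- The truncations `min ‖u‖ n` are bounded and square integrable, hence have finite `L^p` norm, as
  -- the absorption demands. The bound does not depend on `n`, and monotone convergence removes the
  -- truncation.
  have hn : ∀ n : ℕ, ∫⁻ x in Ω, (min ‖u x‖ₑ n) ^ p ≤ (C * slobSq σ Ω u) ^ (p / 2) := by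
    intro n
    have hfin : ∫⁻ x in Ω, (min ‖u x‖ₑ n) ^ p ≠ ⊤ := by
      refine ne_top_of_le_ne_top (b := (n : ℝ≥0∞) ^ (p - 2) * ∫⁻ x in Ω, ‖u x‖ₑ ^ 2)
        (ENNReal.mul_ne_top (ENNReal.rpow_ne_top_of_nonneg (by linarith) (by simp)) hl2) ?_
      rw [← lintegral_const_mul' _ _ (ENNReal.rpow_ne_top_of_nonneg (by linarith) (by simp))]
      refine lintegral_mono fun x => ?_
      rw [← ENNReal.rpow_natCast]
      calc (min ‖u x‖ₑ n) ^ p = (min ‖u x‖ₑ n) ^ (p - 2) * (min ‖u x‖ₑ n) ^ (2 : ℝ) := by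
            rw [← ENNReal.rpow_add_of_nonneg _ _ (by linarith) two_pos.le]; simp
        _ ≤ _ := by
            refine mul_le_mul' (ENNReal.rpow_le_rpow (min_le_right _ _) (by linarith)) ?_
            exact ENNReal.rpow_le_rpow (min_le_left _ _) (by norm_num)
    have := hC u hu (fun x => min ‖u x‖ₑ n) (hu.enorm.min aemeasurable_const) (fun x y => ?_)
      (fun x => min_le_left _ _) hfin
    · rw [← ENNReal.rpow_le_rpow_iff (z := 2 / p) (by positivity), ← ENNReal.rpow_mul]
      have e1 : p / 2 * (2 / p) = 1 := by field_simp
      rw [e1, ENNReal.rpow_one]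
      exact this
    · have h1 : ‖u x‖ₑ ≤ ‖u y‖ₑ + ‖u x - u y‖ₑ := by
        calc ‖u x‖ₑ = ‖u y + (u x - u y)‖ₑ := by congr 1; abel
          _ ≤ _ := enorm_add_le _ _
      rw [min_add]
      exact le_min ((min_le_left _ _).trans h1) ((min_le_right _ _).trans le_self_add)
  have hsup : ∫⁻ x in Ω, ‖u x‖ₑ ^ p ≤ (C * slobSq σ Ω u) ^ (p / 2) := by
    have h1 : ∀ x, ‖u x‖ₑ ^ p ≤ ⨆ n : ℕ, (min ‖u x‖ₑ (n : ℝ≥0∞)) ^ p := by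
      intro x
      obtain ⟨n, hn⟩ := exists_nat_ge ‖u x‖₊
      refine le_iSup_of_le n ?_
      rw [min_eq_left]
      rw [enorm_eq_nnnorm]
      exact_mod_cast hn
    refine (lintegral_mono h1).trans ?_
    rw [lintegral_iSup' (fun n => (hu.enorm.min aemeasurable_const).pow_const p)]
    · exact iSup_le hn
    · refine Filter.Eventually.of_forall fun x m n hmn => ?_
      exact ENNReal.rpow_le_rpow (min_le_min le_rfl (by exact_mod_cast hmn)) hp0.le
  calc _ ≤ ((C * slobSq σ Ω u) ^ (p / 2)) ^ (2 / p) := by gcongr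
    _ = C * slobSq σ Ω u := by
      rw [← ENNReal.rpow_mul, show p / 2 * (2 / p) = 1 by field_simp, ENNReal.rpow_one]
    _ ≤ _ := by gcongr; exact_mod_cast le_self_add

end Sobolev

/-! ### Mollification over cone balls and its derivative in the scale. -/

section Mollifier

variable {E : Type*} [NormedAddCommGroup E] [NormedSpace ℝ E]

lemma inv_smul_sub_mem_closedBall_iff {x y e : R3} {s : ℝ} (hs : 0 < s) :
    s⁻¹ • (y - x) ∈ Metric.closedBall e 1 ↔ y ∈ Metric.closedBall (x + s • e) s := by
  have : y - (x + s • e) = s • (s⁻¹ • (y - x) - e) := by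
    rw [smul_sub, smul_inv_smul₀ hs.ne']; abel
  rw [mem_closedBall_iff_norm, mem_closedBall_iff_norm, this, norm_smul,
    Real.norm_of_nonneg hs.le]
  exact (mul_le_iff_le_one_right hs).symm

lemma exists_mollifier (e : R3) : ∃ ρ : R3 → ℝ, ContDiff ℝ ∞ ρ ∧
    tsupport ρ ⊆ Metric.closedBall e 1 ∧ ∫ z, ρ z = 1 := by
  let f : ContDiffBump e := ⟨1 / 2, 1, by norm_num, by norm_num⟩
  exact ⟨f.normed volume, f.contDiff_normed, (f.tsupport_normed_eq).subset, f.integral_normed⟩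

/-- Minus the derivative of `s ↦ s⁻³ ρ (z / s)` at `s = 1`, the divergence of `z ↦ ρ z • z`. -/
noncomputable def radialDiv (ρ : R3 → ℝ) (z : R3) : ℝ := 3 * ρ z + fderiv ℝ ρ z z

variable {ρ : R3 → ℝ} {e : R3}

lemma hasCompactSupport_of_tsupport (hρs : tsupport ρ ⊆ Metric.closedBall e 1) :
    HasCompactSupport ρ :=
  HasCompactSupport.of_support_subset_isCompact (isCompact_closedBall e 1)
    ((subset_tsupport ρ).trans hρs)

lemma radialDiv_eq_zero (hρs : tsupport ρ ⊆ Metric.closedBall e 1) {z : R3}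
    (hz : z ∉ Metric.closedBall e 1) : radialDiv ρ z = 0 := by
  have h1 : z ∉ tsupport ρ := fun h => hz (hρs h)
  have h2 : fderiv ℝ ρ z = 0 := by
    by_contra h; exact h1 (support_fderiv_subset ℝ h)
  simp [radialDiv, h2, image_eq_zero_of_notMem_tsupport h1]

lemma continuous_radialDiv (hρ : ContDiff ℝ ∞ ρ) : Continuous (radialDiv ρ) := by
  have h1 := hρ.continuous_fderiv (by simp)
  have h2 := hρ.continuous
  unfold radialDiv
  fun_prop

lemma exists_bound_radialDiv (hρ : ContDiff ℝ ∞ ρ) (hρs : tsupport ρ ⊆ Metric.closedBall e 1) :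
    ∃ C : ℝ, ∀ z, |radialDiv ρ z| ≤ C := by
  refine (continuous_radialDiv hρ).bounded_above_of_compact_support ?_
  refine HasCompactSupport.intro (isCompact_closedBall e 1) fun z hz => radialDiv_eq_zero hρs hz

lemma hasDerivAt_dilation (hρ : ContDiff ℝ ∞ ρ) (w : R3) {s : ℝ} (hs : s ≠ 0) :
    HasDerivAt (fun s : ℝ => (s ^ 3)⁻¹ * ρ (s⁻¹ • w))
      (-((s ^ 4)⁻¹ * radialDiv ρ (s⁻¹ • w))) s := by
  have h1 : HasDerivAt (fun s : ℝ => s⁻¹ • w) ((-(s ^ 2)⁻¹) • w) s :=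
    (hasDerivAt_inv hs).smul_const w
  have h2 : HasFDerivAt ρ (fderiv ℝ ρ (s⁻¹ • w)) (s⁻¹ • w) :=
    (hρ.differentiable (by simp) _).hasFDerivAt
  have h3 := h2.comp_hasDerivAt s h1
  have h4 : HasDerivAt (fun s : ℝ => (s ^ 3)⁻¹) _ s := (hasDerivAt_pow 3 s).inv (pow_ne_zero 3 hs)
  refine (h4.mul h3).congr_deriv ?_
  simp only [radialDiv, map_smul, smul_eq_mul, Function.comp]
  field_simp
  push_cast
  ring

/-- The mollification of `u` at `x` on the scale `s`. -/
noncomputable def mollify (ρ : R3 → ℝ) (u : R3 → E) (x : R3) (s : ℝ) : E :=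
  ∫ y, ((s ^ 3)⁻¹ * ρ (s⁻¹ • (y - x))) • u y

lemma hasDerivAt_mollify (hρ : ContDiff ℝ ∞ ρ) (hρs : tsupport ρ ⊆ Metric.closedBall e 1)
    {u : R3 → E} (hu : LocallyIntegrable u) (x : R3) {s : ℝ} (hs : 0 < s) :
    HasDerivAt (mollify ρ u x)
      (∫ y, (-((s ^ 4)⁻¹ * radialDiv ρ (s⁻¹ • (y - x)))) • u y) s := by
  obtain ⟨C, hC⟩ := exists_bound_radialDiv hρ hρs
  have hC0 : 0 ≤ C := (abs_nonneg _).trans (hC 0)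
  -- This ball contains the supports of the kernels of all scales `t ≤ 2 * s`, so one integrable
  -- bound serves all `t` near `s`.
  set K := Metric.closedBall x (2 * s * (‖e‖ + 1))
  have hK : IsCompact K := isCompact_closedBall _ _
  have hc := continuous_radialDiv hρ
  have hc' := hρ.continuous
  have hsub : ∀ t : ℝ, 0 < t → t ≤ 2 * s → ∀ y, y ∉ K → t⁻¹ • (y - x) ∉ Metric.closedBall e 1 := by
    intro t ht hts y hy hmem
    refine hy ?_
    rw [inv_smul_sub_mem_closedBall_iff ht, mem_closedBall_iff_norm] at hmem
    rw [mem_closedBall_iff_norm]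
    calc ‖y - x‖ = ‖(y - (x + t • e)) + t • e‖ := by congr 1; abel
      _ ≤ ‖y - (x + t • e)‖ + ‖t • e‖ := norm_add_le _ _
      _ ≤ t + t * ‖e‖ := by rw [norm_smul, Real.norm_of_nonneg ht.le]; gcongr
      _ = t * (‖e‖ + 1) := by ring
      _ ≤ _ := by gcongr
  have hint : Integrable (K.indicator fun y => ‖u y‖) :=
    (integrable_indicator_iff hK.measurableSet).2 (hu.integrableOn_isCompact hK).norm
  refine (hasDerivAt_integral_of_dominated_loc_of_deriv_le
    (F := fun t y => ((t ^ 3)⁻¹ * ρ (t⁻¹ • (y - x))) • u y)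
    (F' := fun t y => (-((t ^ 4)⁻¹ * radialDiv ρ (t⁻¹ • (y - x)))) • u y)
    (bound := fun y => ((s / 2) ^ 4)⁻¹ * C * K.indicator (fun y => ‖u y‖) y)
    (Metric.ball_mem_nhds s (half_pos hs)) ?_ ?_ ?_ ?_ ?_ ?_).2
  · refine Filter.Eventually.of_forall fun t => ?_
    exact (Continuous.aestronglyMeasurable (by fun_prop)).smul hu.aestronglyMeasurable
  · refine hu.integrable_smul_left_of_hasCompactSupport (by fun_prop) ?_
    refine HasCompactSupport.intro hK fun y hy => ?_
    rw [image_eq_zero_of_notMem_tsupport fun h => hsub s hs (by linarith) y hy (hρs h), mul_zero]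
  · exact (Continuous.aestronglyMeasurable (by fun_prop)).smul hu.aestronglyMeasurable
  · refine Filter.Eventually.of_forall fun y t ht => ?_
    rw [Metric.mem_ball, Real.dist_eq, abs_lt] at ht
    have ht0 : s / 2 < t := by linarith [ht.1]
    have ht0' : 0 < t := by linarith
    by_cases hy : y ∈ K
    · rw [indicator_of_mem hy, norm_smul, norm_neg, Real.norm_eq_abs, abs_mul, abs_inv, abs_pow,
        abs_of_pos ht0']
      gcongr
      exact hC _
    · rw [radialDiv_eq_zero hρs (hsub t ht0' (by linarith) y hy)]
      simp [hy]
  · exact hint.const_mul _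
  · refine Filter.Eventually.of_forall fun y t ht => ?_
    rw [Metric.mem_ball, Real.dist_eq, abs_lt] at ht
    exact (hasDerivAt_dilation hρ (y - x) (by linarith : t ≠ 0)).smul_const _

/-- The components of the vector field `y ↦ s⁻³ ρ (z) z` with `z = (y - x) / s`. -/
noncomputable def radialField (ρ : R3 → ℝ) (x : R3) (s : ℝ) (i : Fin 3) (y : R3) : ℝ :=
  (s ^ 3)⁻¹ * ((s⁻¹ • (y - x)) i * ρ (s⁻¹ • (y - x)))

lemma contDiff_radialField (hρ : ContDiff ℝ ∞ ρ) (x : R3) (s : ℝ) (i : Fin 3) :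
    ContDiff ℝ ∞ (radialField ρ x s i) := by
  unfold radialField
  fun_prop

lemma radialField_eq_zero (hρs : tsupport ρ ⊆ Metric.closedBall e 1) {x y : R3} {s : ℝ}
    (hs : 0 < s) (i : Fin 3) (hy : y ∉ Metric.closedBall (x + s • e) s) :
    radialField ρ x s i y = 0 := by
  rw [← inv_smul_sub_mem_closedBall_iff hs] at hy
  simp [radialField, image_eq_zero_of_notMem_tsupport fun h => hy (hρs h)]

lemma tsupport_radialField (hρs : tsupport ρ ⊆ Metric.closedBall e 1) (x : R3) {s : ℝ}
    (hs : 0 < s) (i : Fin 3) :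
    tsupport (radialField ρ x s i) ⊆ Metric.closedBall (x + s • e) s := by
  refine closure_minimal (fun y hy => ?_) Metric.isClosed_closedBall
  by_contra h
  exact hy (radialField_eq_zero hρs hs i h)

lemma fderiv_radialField (hρ : ContDiff ℝ ∞ ρ) (x : R3) (s : ℝ) (i : Fin 3) (y : R3) :
    fderiv ℝ (radialField ρ x s i) y (EuclideanSpace.single i 1) =
      (s ^ 3)⁻¹ * (s⁻¹ * ρ (s⁻¹ • (y - x)) +
        s⁻¹ * ((s⁻¹ • (y - x)) i * fderiv ℝ ρ (s⁻¹ • (y - x)) (EuclideanSpace.single i 1))) := by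
  have h1 : HasFDerivAt (fun y : R3 => s⁻¹ • (y - x)) (s⁻¹ • ContinuousLinearMap.id ℝ R3) y :=
    ((hasFDerivAt_id y).sub_const x).const_smul s⁻¹
  have h2 : HasFDerivAt ρ (fderiv ℝ ρ (s⁻¹ • (y - x))) (s⁻¹ • (y - x)) :=
    (hρ.differentiable (by simp) _).hasFDerivAt
  have h3 := h2.comp y h1
  have h4 : HasFDerivAt (fun y : R3 => (s⁻¹ • (y - x)) i)
      ((EuclideanSpace.proj i : R3 →L[ℝ] ℝ).comp (s⁻¹ • ContinuousLinearMap.id ℝ R3)) y :=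
    (EuclideanSpace.proj i : R3 →L[ℝ] ℝ).hasFDerivAt.comp y h1
  have h5 : HasFDerivAt (radialField ρ x s i) _ y := (h4.mul h3).const_mul ((s ^ 3)⁻¹)
  rw [h5.fderiv]
  simp
  ring

/-- With `hasDerivAt_dilation`, this shows that the scale derivative of the kernel is minus a
divergence in `y`, which permits an integration by parts. -/
lemma sum_fderiv_radialField (hρ : ContDiff ℝ ∞ ρ) (x : R3) (s : ℝ) (y : R3) :
    ∑ i, fderiv ℝ (radialField ρ x s i) y (EuclideanSpace.single i 1) =
      (s ^ 4)⁻¹ * radialDiv ρ (s⁻¹ • (y - x)) := by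
  simp_rw [fderiv_radialField hρ]
  set z := s⁻¹ • (y - x)
  have hz : fderiv ℝ ρ z z = ∑ i, z i * fderiv ℝ ρ z (EuclideanSpace.single i 1) := by
    have h := congrArg (fderiv ℝ ρ z) ((EuclideanSpace.basisFun (Fin 3) ℝ).sum_repr z).symm
    simpa only [map_sum, map_smul, smul_eq_mul, EuclideanSpace.basisFun_repr,
      EuclideanSpace.basisFun_apply] using h
  rw [radialDiv, hz]
  simp only [← Finset.mul_sum, Finset.sum_add_distrib, Finset.sum_const, Finset.card_univ,
    Fintype.card_fin, nsmul_eq_mul]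
  push_cast
  ring

end Mollifier

/-! ### Morrey's inequality and the embedding into `L^∞`. -/

section Morrey

variable {E : Type*} [NormedAddCommGroup E] [NormedSpace ℝ E]

lemma enorm_setIntegral_smul_le {Ω B : Set R3} (hBm : MeasurableSet B) (hB : B ⊆ Ω) {p : ℝ}
    (hp : 1 ≤ p) {w : R3 → E} (hw : AEStronglyMeasurable w (volume.restrict Ω)) {φ : R3 → ℝ} {c : ℝ}
    (hφ : ∀ y, |φ y| ≤ c) (hφ0 : ∀ y, y ∉ B → φ y = 0) :
    ‖∫ y in Ω, φ y • w y‖ₑ ≤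
      ENNReal.ofReal c * (volume B ^ (1 - 1 / p) * (∫⁻ y in Ω, ‖w y‖ₑ ^ p) ^ (1 / p)) := by
  have hp0 : 0 < p := by linarith
  have hwB : AEStronglyMeasurable w (volume.restrict B) :=
    hw.mono_measure (Measure.restrict_mono hB le_rfl)
  calc ‖∫ y in Ω, φ y • w y‖ₑ ≤ ∫⁻ y in Ω, ‖φ y • w y‖ₑ := enorm_integral_le_lintegral_enorm _
    _ ≤ ∫⁻ y in Ω, B.indicator (fun y => ENNReal.ofReal c * ‖w y‖ₑ) y := by
        refine lintegral_mono fun y => ?_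
        by_cases hy : y ∈ B
        · rw [indicator_of_mem hy, enorm_smul]
          gcongr
          rw [← ofReal_norm]
          exact ENNReal.ofReal_le_ofReal (hφ y)
        · simp [hφ0 y hy]
    _ = ENNReal.ofReal c * ∫⁻ y in B, ‖w y‖ₑ := by
        rw [lintegral_indicator hBm, Measure.restrict_restrict_of_subset hB,
          lintegral_const_mul' _ _ ENNReal.ofReal_ne_top]
    _ ≤ _ := by
        gcongr
        refine (lintegral_le_measure_rpow_mul hwB.enorm hp).trans ?_
        rw [Measure.restrict_apply_univ]
        gcongr

variable {ρ : R3 → ℝ} {e : R3}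

lemma setIntegral_smul_eq_integral_indicator {Ω : Set R3} (hΩm : MeasurableSet Ω) (φ : R3 → ℝ)
    (u : R3 → E) : ∫ y, φ y • Ω.indicator u y = ∫ y in Ω, φ y • u y := by
  rw [← integral_indicator hΩm]
  congr 1
  ext y
  by_cases hy : y ∈ Ω <;> simp [hy]

/-- The scale derivative of the kernel is minus the divergence of `radialField`, whose components
are test functions supported in a cone ball, hence in `Ω`. The definition of the weak derivative
applies to each, and the two signs cancel. -/
lemma hasDerivAt_mollify_of_hasWeakPartial (hρ : ContDiff ℝ ∞ ρ)
    (hρs : tsupport ρ ⊆ Metric.closedBall e 1) {Ω : Set R3} (hΩm : MeasurableSet Ω)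
    (hΩ : ContainsCone Ω e) {u : R3 → E} (hu : LocallyIntegrable (Ω.indicator u))
    {v : Fin 3 → R3 → E} (huv : ∀ i, HasWeakPartial Ω i u (v i)) {x : R3} (hx : x ∈ Ω)
    {s : ℝ} (hs : 0 < s) :
    HasDerivAt (mollify ρ (Ω.indicator u) x)
      (∑ i, ∫ y in Ω, radialField ρ x s i y • v i y) s := by
  refine (hasDerivAt_mollify hρ hρs hu x hs).congr_deriv ?_
  have hcs : ∀ i, HasCompactSupport (radialField ρ x s i) := fun i =>
    HasCompactSupport.intro (isCompact_closedBall _ _) fun y hy => radialField_eq_zero hρs hs i hy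
  have hsm := contDiff_radialField hρ x s
  calc _ = -∫ y, ∑ i, fderiv ℝ (radialField ρ x s i) y (EuclideanSpace.single i 1) •
          Ω.indicator u y := by
        rw [← integral_neg]
        congr 1
        ext y
        rw [← Finset.sum_smul, sum_fderiv_radialField hρ, neg_smul]
    _ = -∑ i, ∫ y in Ω, fderiv ℝ (radialField ρ x s i) y (EuclideanSpace.single i 1) • u y := by
        rw [integral_finsetSum]
        · simp_rw [setIntegral_smul_eq_integral_indicator hΩm]
        · intro i _
          refine hu.integrable_smul_left_of_hasCompactSupport ?_ ?_
          · exact ((hsm i).continuous_fderiv (by simp)).clm_apply continuous_const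
          · exact (hcs i).fderiv_apply ℝ _
    _ = _ := by
        rw [← Finset.sum_neg_distrib]
        refine Finset.sum_congr rfl fun i _ => ?_
        rw [(huv i).2.2 _ (hsm i) (hcs i) ((tsupport_radialField hρs x hs i).trans (hΩ x hx s hs)),
          neg_neg]

lemma volume_closedBall_R3 (x : R3) {s : ℝ} (hs : 0 ≤ s) :
    volume (Metric.closedBall x s) =
      ENNReal.ofReal s ^ (3 : ℝ) * volume (Metric.ball (0 : R3) 1) := by
  rw [Measure.addHaar_closedBall _ _ hs, ENNReal.ofReal_pow hs, ← ENNReal.rpow_natCast,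
    finrank_R3]

/-- The field is of size `s⁻³` on a ball of volume comparable to `s³`, so Hölder leaves `s^(-3) *
s^(3(1 - 1/p)) = s^(-3/p)`. -/
lemma exists_bound_deriv_mollify (hρ : ContDiff ℝ ∞ ρ)
    (hρs : tsupport ρ ⊆ Metric.closedBall e 1) {Ω : Set R3}
    (hΩ : ContainsCone Ω e) {p : ℝ} (hp : 1 ≤ p) :
    ∃ C : ℝ≥0, ∀ v : Fin 3 → R3 → E, (∀ i, AEStronglyMeasurable (v i) (volume.restrict Ω)) →
      ∀ x ∈ Ω, ∀ s : ℝ, 0 < s →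
      ‖∑ i, ∫ y in Ω, radialField ρ x s i y • v i y‖ₑ ≤
        C * ENNReal.ofReal s ^ (-(3 / p)) * ∑ i, (∫⁻ y in Ω, ‖v i y‖ₑ ^ p) ^ (1 / p) := by
  have hp0 : 0 < p := by linarith
  have hp1 : 1 / p ≤ 1 := by rw [div_le_one hp0]; exact hp
  have hcs := hasCompactSupport_of_tsupport hρs
  have hbd : ∀ i : Fin 3, ∃ C : ℝ, ∀ z : R3, |z i * ρ z| ≤ C := fun i =>
    Continuous.bounded_above_of_compact_support
      (by have := hρ.continuous; fun_prop) (hcs.mul_left (f := fun z : R3 => z i))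
  choose c hc using hbd
  set b := volume (Metric.ball (0 : R3) 1)
  have hbt : b ≠ ⊤ := measure_ball_lt_top.ne
  set D := ∑ i, ENNReal.ofReal (c i) * b ^ (1 - 1 / p)
  have hD : D ≠ ⊤ := by
    refine (ENNReal.sum_lt_top.2 fun i _ => ?_).ne
    exact ENNReal.mul_lt_top ENNReal.ofReal_lt_top
      (ENNReal.rpow_lt_top_of_nonneg (by linarith) hbt)
  refine ⟨D.toNNReal, fun v hv x hx s hs => ?_⟩
  rw [ENNReal.coe_toNNReal hD]
  have hS0 : ENNReal.ofReal s ≠ 0 := by simpa using hs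
  have hSt : ENNReal.ofReal s ≠ ⊤ := ENNReal.ofReal_ne_top
  refine (enorm_sum_le _ _).trans ?_
  rw [Finset.mul_sum]
  refine Finset.sum_le_sum fun i _ => ?_
  have h1 := enorm_setIntegral_smul_le (c := (s ^ 3)⁻¹ * c i) Metric.isClosed_closedBall.measurableSet
    (hΩ x hx s hs) hp (hv i) (φ := radialField ρ x s i) (fun y => by
      rw [radialField, abs_mul, abs_of_pos (by positivity)]
      gcongr
      exact hc i _) (fun y hy => radialField_eq_zero hρs hs i hy)
  refine h1.trans ?_
  have e1 : ENNReal.ofReal ((s ^ 3)⁻¹) = ENNReal.ofReal s ^ (-3 : ℝ) := by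
    rw [ENNReal.ofReal_inv_of_pos (by positivity), ENNReal.ofReal_pow hs.le, ENNReal.rpow_neg,
      ← ENNReal.rpow_natCast]
    norm_num
  have e2 : ENNReal.ofReal s ^ (-3 : ℝ) * ENNReal.ofReal s ^ (3 * (1 - 1 / p)) =
      ENNReal.ofReal s ^ (-(3 / p)) := by
    rw [← ENNReal.rpow_add _ _ hS0 hSt]; ring_nf
  rw [volume_closedBall_R3 _ hs.le, ENNReal.ofReal_mul (by positivity), e1,
    ENNReal.mul_rpow_of_nonneg _ _ (by linarith), ← ENNReal.rpow_mul, ← e2]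
  have hle : ENNReal.ofReal (c i) * b ^ (1 - 1 / p) ≤ D :=
    Finset.single_le_sum (f := fun i => ENNReal.ofReal (c i) * b ^ (1 - 1 / p))
      (fun _ _ => zero_le) (Finset.mem_univ i)
  calc _ = ENNReal.ofReal (c i) * b ^ (1 - 1 / p) *
        (ENNReal.ofReal s ^ (-3 : ℝ) * ENNReal.ofReal s ^ (3 * (1 - 1 / p))) *
        (∫⁻ y in Ω, ‖v i y‖ₑ ^ p) ^ (1 / p) := by ring
    _ ≤ _ := by gcongr

lemma enorm_mollify_one_le (hρ : ContDiff ℝ ∞ ρ)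
    (hρs : tsupport ρ ⊆ Metric.closedBall e 1) {Ω : Set R3} (hΩm : MeasurableSet Ω)
    (hΩ : ContainsCone Ω e) :
    ∃ C : ℝ≥0, ∀ u : R3 → E, AEStronglyMeasurable u (volume.restrict Ω) → ∀ x ∈ Ω,
      ‖mollify ρ (Ω.indicator u) x 1‖ₑ ≤ C * l2Sq Ω u ^ (1 / 2 : ℝ) := by
  obtain ⟨c, hc⟩ := hρ.continuous.bounded_above_of_compact_support
    (hasCompactSupport_of_tsupport hρs)
  set D := ENNReal.ofReal c * volume (Metric.ball (0 : R3) 1) ^ (1 - 1 / 2 : ℝ)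
  have hD : D ≠ ⊤ := ENNReal.mul_ne_top ENNReal.ofReal_ne_top
    (ENNReal.rpow_ne_top_of_nonneg (by norm_num) measure_ball_lt_top.ne)
  refine ⟨D.toNNReal, fun u hu x hx => ?_⟩
  rw [ENNReal.coe_toNNReal hD]
  have h1 := enorm_setIntegral_smul_le (c := c) Metric.isClosed_closedBall.measurableSet
    (hΩ x hx 1 one_pos) one_le_two hu (φ := fun y => ((1 : ℝ) ^ 3)⁻¹ * ρ ((1 : ℝ)⁻¹ • (y - x)))
    (fun y => by simpa using hc (y - x)) (fun y hy => by
      rw [← inv_smul_sub_mem_closedBall_iff one_pos] at hy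
      rw [image_eq_zero_of_notMem_tsupport fun h => hy (hρs h), mul_zero])
  rw [mollify, setIntegral_smul_eq_integral_indicator hΩm]
  refine h1.trans_eq ?_
  rw [volume_closedBall_R3 _ zero_le_one, l2Sq]
  simp [D, mul_assoc]

/-- Since `α > 0`, the majorant `κ * s^(α - 1)` is integrable at `0`, with integral `κ / α` over
`(0, 1)`. The bound therefore survives the limit `s → 0`. -/
lemma norm_mollify_le_of_deriv {A A' : ℝ → E} {κ α : ℝ} (hα : 0 < α)
    (hA : ∀ s, 0 < s → HasDerivAt A (A' s) s) (hA' : ∀ s, 0 < s → ‖A' s‖ ≤ κ * s ^ (α - 1))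
    {s : ℝ} (hs : 0 < s) (hs1 : s ≤ 1) : ‖A s‖ ≤ ‖A 1‖ + κ / α := by
  have hκ : 0 ≤ κ := by
    have := (norm_nonneg _).trans (hA' 1 one_pos)
    simpa using this
  have h := image_norm_le_of_norm_deriv_right_le_deriv_boundary' (f := fun t => A t - A s)
    (f' := A') (a := s) (b := 1) (B := fun t => κ / α * (t ^ α - s ^ α))
    (B' := fun t => κ * t ^ (α - 1))
    (fun t ht => ((hA t (hs.trans_le ht.1)).sub_const _).continuousAt.continuousWithinAt)
    (fun t ht => ((hA t (hs.trans_le ht.1)).sub_const _).hasDerivWithinAt)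
    (by simp)
    (fun t ht => ((((Real.hasDerivAt_rpow_const (Or.inl (hs.trans_le ht.1).ne')).sub_const
      _).const_mul _).continuousAt.continuousWithinAt))
    (fun t ht => by
      refine ((((Real.hasDerivAt_rpow_const (p := α) (Or.inl (hs.trans_le ht.1).ne')).sub_const
        (s ^ α)).const_mul (κ / α)).congr_deriv ?_).hasDerivWithinAt
      field_simp)
    (fun t ht => hA' t (hs.trans_le ht.1)) (right_mem_Icc.2 hs1)
  have h2 : κ / α * ((1 : ℝ) ^ α - s ^ α) ≤ κ / α := by
    rw [Real.one_rpow]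
    refine mul_le_of_le_one_right (by positivity) ?_
    linarith [Real.rpow_nonneg hs.le α]
  calc ‖A s‖ = ‖A 1 - (A 1 - A s)‖ := by congr 1; abel
    _ ≤ ‖A 1‖ + ‖A 1 - A s‖ := norm_sub_le _ _
    _ ≤ _ := by gcongr; exact h.trans h2

lemma integral_dilation_eq_one (hρ1 : ∫ z, ρ z = 1) (x : R3) {s : ℝ} (hs : 0 < s) :
    ∫ y, (s ^ 3)⁻¹ * ρ (s⁻¹ • (y - x)) = 1 := by
  rw [integral_const_mul, integral_sub_right_eq_self (fun y => ρ (s⁻¹ • y)) x,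
    Measure.integral_comp_inv_smul, hρ1]
  simp only [finrank_euclideanSpace, Fintype.card_fin, smul_eq_mul, mul_one]
  rw [abs_of_pos (by positivity), inv_mul_cancel₀ (by positivity)]

/-- The averaging balls are not centred at `x`, but their centres lie within `‖e‖ * s` of it.
Lebesgue differentiation for doubling measures allows such eccentric balls. -/
lemma ae_tendsto_mollify [CompleteSpace E] (hρ : ContDiff ℝ ∞ ρ)
    (hρs : tsupport ρ ⊆ Metric.closedBall e 1) (hρ1 : ∫ z, ρ z = 1) {u : R3 → E}
    (hu : LocallyIntegrable u) :
    ∀ᵐ x, Filter.Tendsto (mollify ρ u x) (nhdsWithin 0 (Ioi 0)) (nhds (u x)) := by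
  obtain ⟨c, hc⟩ := hρ.continuous.bounded_above_of_compact_support
    (hasCompactSupport_of_tsupport hρs)
  have hc0 : 0 ≤ c := (norm_nonneg _).trans (hc 0)
  have hcont := hρ.continuous
  filter_upwards [IsUnifLocDoublingMeasure.ae_tendsto_average_norm_sub volume hu ‖e‖] with x hx
  have h1 := hx (fun s : ℝ => x + s • e) (fun s => s) (l := nhdsWithin 0 (Ioi 0)) Filter.tendsto_id
    (by
      filter_upwards [self_mem_nhdsWithin] with s (hs : 0 < s)
      rw [mem_closedBall_iff_norm]
      simp [norm_smul, abs_of_pos hs, mul_comm])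
  set b := volume.real (Metric.ball (0 : R3) 1)
  have hb : 0 < b := ENNReal.toReal_pos (Metric.measure_ball_pos _ _ one_pos).ne'
    measure_ball_lt_top.ne
  rw [tendsto_iff_norm_sub_tendsto_zero]
  refine squeeze_zero' (Filter.Eventually.of_forall fun _ => norm_nonneg _) ?_
    (by simpa using h1.const_mul (c * b))
  filter_upwards [self_mem_nhdsWithin] with s (hs : 0 < s)
  set k : R3 → ℝ := fun y => (s ^ 3)⁻¹ * ρ (s⁻¹ • (y - x)) with hk
  set B := Metric.closedBall (x + s • e) s
  have hBc : IsCompact B := isCompact_closedBall _ _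
  have hk0 : ∀ y, y ∉ B → k y = 0 := fun y hy => by
    rw [← inv_smul_sub_mem_closedBall_iff hs] at hy
    simp [hk, image_eq_zero_of_notMem_tsupport fun h => hy (hρs h)]
  have hkc : Continuous k := by fun_prop
  have hks : HasCompactSupport k := HasCompactSupport.intro hBc hk0
  have hki : Integrable k := hkc.integrable_of_hasCompactSupport hks
  have hdiff : mollify ρ u x s - u x = ∫ y, k y • (u y - u x) := by
    have : ∫ y, k y • u x = u x := by
      rw [integral_smul_const, integral_dilation_eq_one hρ1 x hs, one_smul]
    simp_rw [smul_sub]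
    rw [integral_sub (hu.integrable_smul_left_of_hasCompactSupport hkc hks) (hki.smul_const _), this]
    rfl
  have hint : IntegrableOn (fun y => ‖u y - u x‖) B :=
    ((hu.sub (locallyIntegrable_const (u x))).integrableOn_isCompact hBc).norm
  have hBr : volume.real B = s ^ 3 * b := by
    rw [Measure.real, Measure.addHaar_closedBall _ _ hs.le, ENNReal.toReal_mul,
      ENNReal.toReal_ofReal (by positivity)]
    simp [b, Measure.real]
  calc ‖mollify ρ u x s - u x‖ = ‖∫ y, k y • (u y - u x)‖ := by rw [hdiff]
    _ ≤ ∫ y, B.indicator (fun y => (s ^ 3)⁻¹ * c * ‖u y - u x‖) y := by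
        refine norm_integral_le_of_norm_le
          ((integrable_indicator_iff hBc.measurableSet).2 (hint.const_mul _)) ?_
        refine Filter.Eventually.of_forall fun y => ?_
        by_cases hy : y ∈ B
        · rw [indicator_of_mem hy, norm_smul, hk, norm_mul, Real.norm_of_nonneg (by positivity)]
          gcongr
          exact hc _
        · simp [hy, hk0 y hy]
    _ = (s ^ 3)⁻¹ * c * ∫ y in B, ‖u y - u x‖ := by
        rw [integral_indicator hBc.measurableSet, integral_const_mul]
    _ = c * b * ⨍ y in B, ‖u y - u x‖ := by
        rw [setAverage_eq, hBr, smul_eq_mul, mul_inv]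
        field_simp

/-- Morrey's inequality on domains with the cone property. -/
theorem ae_enorm_le_of_hasWeakPartial [CompleteSpace E] {Ω : Set R3} (hΩm : MeasurableSet Ω)
    {e : R3} (hΩ : ContainsCone Ω e) {p : ℝ} (hp : 3 < p) :
    ∃ C : ℝ≥0, ∀ (u : R3 → E) (v : Fin 3 → R3 → E), (∀ i, HasWeakPartial Ω i u (v i)) →
      ∀ᵐ x ∂(volume.restrict Ω), ‖u x‖ₑ ≤
        C * (l2Sq Ω u ^ (1 / 2 : ℝ) + ∑ i, (∫⁻ y in Ω, ‖v i y‖ₑ ^ p) ^ (1 / p)) := by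
  obtain ⟨ρ, hρ, hρs, hρ1⟩ := exists_mollifier e
  obtain ⟨C₁, hC₁⟩ := enorm_mollify_one_le (E := E) hρ hρs hΩm hΩ
  obtain ⟨C₂, hC₂⟩ := exists_bound_deriv_mollify (E := E) hρ hρs hΩ (by linarith : 1 ≤ p)
  have hp0 : 0 < p := by linarith
  set α := 1 - 3 / p with hα
  have hα0 : 0 < α := by rw [hα, sub_pos, div_lt_one hp0]; exact hp
  refine ⟨C₁ + C₂ * (α⁻¹).toNNReal + 1, fun u v huv => ?_⟩
  set N := ∑ i, (∫⁻ y in Ω, ‖v i y‖ₑ ^ p) ^ (1 / p)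
  have hne : ((C₁ + C₂ * (α⁻¹).toNNReal + 1 : ℝ≥0) : ℝ≥0∞) ≠ 0 := by
    rw [ENNReal.coe_ne_zero]; positivity
  rcases eq_or_ne (l2Sq Ω u) ⊤ with ht | ht
  · refine Filter.Eventually.of_forall fun x => ?_
    rw [ht, ENNReal.top_rpow_of_pos (by norm_num), top_add, ENNReal.mul_top hne]
    exact le_top
  rcases eq_or_ne N ⊤ with hN | hN
  · refine Filter.Eventually.of_forall fun x => ?_
    rw [hN, add_top, ENNReal.mul_top hne]
    exact le_top
  have hum : AEStronglyMeasurable u (volume.restrict Ω) := (huv 0).1.aestronglyMeasurable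
  have hvm : ∀ i, AEStronglyMeasurable (v i) (volume.restrict Ω) :=
    fun i => (huv i).2.1.aestronglyMeasurable
  have hmem : MemLp (Ω.indicator u) 2 volume := by
    rw [memLp_indicator_iff_restrict hΩm]
    refine ⟨hum, ?_⟩
    rw [eLpNorm_lt_top_iff_lintegral_rpow_enorm_lt_top (by norm_num) (by norm_num)]
    simpa [l2Sq, lt_top_iff_ne_top] using ht
  have hloc : LocallyIntegrable (Ω.indicator u) := hmem.locallyIntegrable (by norm_num)
  rw [ae_restrict_iff' hΩm]
  filter_upwards [ae_tendsto_mollify hρ hρs hρ1 hloc] with x hlim hx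
  set κ := (C₂ : ℝ) * N.toReal
  have hbound : ∀ s : ℝ, 0 < s → s ≤ 1 → ‖mollify ρ (Ω.indicator u) x s‖ ≤
      ‖mollify ρ (Ω.indicator u) x 1‖ + κ / α := by
    intro s hs hs1
    refine norm_mollify_le_of_deriv hα0
      (fun s hs => hasDerivAt_mollify_of_hasWeakPartial hρ hρs hΩm hΩ hloc huv hx hs) ?_ hs hs1
    intro s hs
    have h := ENNReal.toReal_mono (ENNReal.mul_ne_top (ENNReal.mul_ne_top ENNReal.coe_ne_top
      (by rw [ENNReal.ofReal_rpow_of_pos hs]; exact ENNReal.ofReal_ne_top)) hN) (hC₂ v hvm x hx s hs)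
    rw [toReal_enorm, ENNReal.toReal_mul, ENNReal.toReal_mul, ENNReal.ofReal_rpow_of_pos hs,
      ENNReal.toReal_ofReal (by positivity)] at h
    refine h.trans_eq ?_
    rw [hα, show 1 - 3 / p - 1 = -(3 / p) by ring, ENNReal.coe_toReal]
    ring
  have hfin : ‖Ω.indicator u x‖ ≤ ‖mollify ρ (Ω.indicator u) x 1‖ + κ / α := by
    refine le_of_tendsto hlim.norm ?_
    have : Ioc (0 : ℝ) 1 ∈ nhdsWithin (0 : ℝ) (Ioi 0) := Ioc_mem_nhdsGT one_pos
    filter_upwards [this] with s hs using hbound s hs.1 hs.2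
  rw [indicator_of_mem hx] at hfin
  calc ‖u x‖ₑ = ENNReal.ofReal ‖u x‖ := (ofReal_norm _).symm
    _ ≤ ENNReal.ofReal (‖mollify ρ (Ω.indicator u) x 1‖ + κ / α) := ENNReal.ofReal_le_ofReal hfin
    _ = ‖mollify ρ (Ω.indicator u) x 1‖ₑ + C₂ * (α⁻¹).toNNReal * N := by
        rw [ENNReal.ofReal_add (norm_nonneg _) (by positivity), ofReal_norm, div_eq_mul_inv,
          ENNReal.ofReal_mul (by positivity), ENNReal.ofReal_mul (by positivity),
          ENNReal.ofReal_toReal hN, ENNReal.ofReal_coe_nnreal, mul_right_comm]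
        rfl
    _ ≤ C₁ * l2Sq Ω u ^ (1 / 2 : ℝ) + C₂ * (α⁻¹).toNNReal * N := by
        gcongr
        exact hC₁ u hum x hx
    _ ≤ _ := by
        rw [mul_add]
        push_cast
        gcongr
        · rw [add_assoc]; exact le_self_add
        · rw [add_assoc, add_left_comm]; exact le_self_add

/-- Embedding `W₂^{1+σ}(Ω) ⊂ L^∞(Ω)` for `1/2 < σ`. -/
theorem essSup_sq_le_slobOneSq [CompleteSpace E] {Ω : Set R3} (hΩm : MeasurableSet Ω)
    {e : R3} (hΩ : ContainsCone Ω e) {σ : ℝ} (hσ : 1 / 2 < σ) :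
    ∃ C : ℝ≥0, ∀ u : R3 → E,
      essSup (fun x => ‖u x‖ₑ) (volume.restrict Ω) ^ 2 ≤ C * slobOneSq σ Ω u := by
  -- Below `3/2` the exponent is the critical one, with `3/2 - 3/p = σ`; it exceeds `3` exactly
  -- because `σ > 1/2`.
  obtain ⟨p, hp3, hpσ⟩ : ∃ p : ℝ, 3 < p ∧ 3 / 2 - 3 / p ≤ σ := by
    rcases le_or_gt (3 / 2) σ with h | h
    · exact ⟨4, by norm_num, by linarith⟩
    · refine ⟨3 / (3 / 2 - σ), ?_, ?_⟩
      · rw [lt_div_iff₀ (by linarith)]; linarith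
      · rw [div_div_cancel₀ (by norm_num)]; linarith
  have hp0 : 0 < p := by linarith
  obtain ⟨C₁, hC₁⟩ := ae_enorm_le_of_hasWeakPartial (E := E) hΩm hΩ hp3
  obtain ⟨C₂, hC₂⟩ := lintegral_rpow_le_slobSq (E := E) hΩm hΩ (by linarith : 0 < σ)
    (by linarith : 2 < p) hpσ
  refine ⟨C₁ ^ 2 * (8 * (1 + C₂)) + 1, fun u => ?_⟩
  have hne : ((C₁ ^ 2 * (8 * (1 + C₂)) + 1 : ℝ≥0) : ℝ≥0∞) ≠ 0 := by
    rw [ENNReal.coe_ne_zero]; positivity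
  rw [slobOneSq, ENNReal.mul_iInf_of_ne hne ENNReal.coe_ne_top]
  refine le_iInf fun v => ?_
  rw [ENNReal.mul_iInf_of_ne hne ENNReal.coe_ne_top]
  refine le_iInf fun huv => ?_
  set n : Fin 3 → ℝ≥0∞ := fun i => (∫⁻ y in Ω, ‖v i y‖ₑ ^ p) ^ (1 / p) with hn
  have hsup : essSup (fun x => ‖u x‖ₑ) (volume.restrict Ω) ≤
      C₁ * (l2Sq Ω u ^ (1 / 2 : ℝ) + ∑ i, n i) := essSup_le_of_ae_le _ (hC₁ u v huv)
  have hn2 : ∀ i, n i ^ 2 ≤ C₂ * (l2Sq Ω (v i) + slobSeminormSq σ Ω (v i)) := by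
    intro i
    refine le_trans (le_of_eq ?_) (hC₂ (v i) (huv i).2.1.aestronglyMeasurable)
    rw [hn, ← ENNReal.rpow_natCast, ← ENNReal.rpow_mul]
    ring_nf
  have ha2 : (l2Sq Ω u ^ (1 / 2 : ℝ)) ^ 2 = l2Sq Ω u := by
    rw [← ENNReal.rpow_natCast, ← ENNReal.rpow_mul]; simp
  have hsum : (∑ i, n i) ^ 2 ≤ 4 * ∑ i, n i ^ 2 := by
    rw [Fin.sum_univ_three, Fin.sum_univ_three]
    calc _ ≤ 2 * ((n 0 + n 1) ^ 2 + n 2 ^ 2) := ENNReal.add_sq_le_two_mul _ _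
      _ ≤ 2 * (2 * (n 0 ^ 2 + n 1 ^ 2) + 2 * n 2 ^ 2) := by
          gcongr
          · exact ENNReal.add_sq_le_two_mul _ _
          · exact le_mul_of_one_le_left zero_le one_le_two
      _ = _ := by ring
  calc _ ≤ (C₁ * (l2Sq Ω u ^ (1 / 2 : ℝ) + ∑ i, n i)) ^ 2 := by gcongr
    _ = C₁ ^ 2 * (l2Sq Ω u ^ (1 / 2 : ℝ) + ∑ i, n i) ^ 2 := by ring
    _ ≤ C₁ ^ 2 * (2 * (1 * l2Sq Ω u + 4 * ∑ i, n i ^ 2)) := by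
        gcongr
        refine (ENNReal.add_sq_le_two_mul _ _).trans ?_
        rw [ha2, one_mul]
        gcongr
    _ ≤ C₁ ^ 2 * (2 * (4 * l2Sq Ω u +
          4 * ∑ i, C₂ * (l2Sq Ω (v i) + slobSeminormSq σ Ω (v i)))) := by
        gcongr
        · norm_num
        · exact hn2 _
    _ = C₁ ^ 2 * (8 * (1 * l2Sq Ω u +
          C₂ * (∑ i, l2Sq Ω (v i) + ∑ i, slobSeminormSq σ Ω (v i)))) := by
        rw [← Finset.mul_sum, Finset.sum_add_distrib]; ring
    _ ≤ C₁ ^ 2 * (8 * ((1 + C₂) * l2Sq Ω u +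
          (1 + C₂) * (∑ i, l2Sq Ω (v i) + ∑ i, slobSeminormSq σ Ω (v i)))) := by
        gcongr
        · exact le_self_add
        · exact le_add_self
    _ = ((C₁ ^ 2 * (8 * (1 + C₂)) : ℝ≥0) : ℝ≥0∞) *
          (l2Sq Ω u + ∑ i, l2Sq Ω (v i) + ∑ i, slobSeminormSq σ Ω (v i)) := by
        push_cast; ring
    _ ≤ _ := by
        gcongr
        exact le_self_add

end Morrey

/-! ### Invariance under changes on null sets, and measurability. -/

section Congr

variable {V : Type*} [MeasureSpace V] {E : Type*} [NormedAddCommGroup E]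

lemma l2Sq_congr_ae {S : Set V} {u v : V → E} (h : u =ᵐ[volume.restrict S] v) :
    l2Sq S u = l2Sq S v :=
  lintegral_congr_ae (h.mono fun x hx => by simp only [hx])

variable [NormedAddCommGroup V] [NormedSpace ℝ V]

lemma slobSeminormSq_congr_ae (σ : ℝ) {S : Set V} {u v : V → E}
    (h : u =ᵐ[volume.restrict S] v) : slobSeminormSq σ S u = slobSeminormSq σ S v :=
  lintegral_congr_ae (h.mono fun x hx => lintegral_congr_ae (h.mono fun y hy => by
    simp only [hx, hy]))

lemma slobSq_congr_ae (σ : ℝ) {S : Set V} {u v : V → E}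
    (h : u =ᵐ[volume.restrict S] v) : slobSq σ S u = slobSq σ S v := by
  rw [slobSq, slobSq, l2Sq_congr_ae h, slobSeminormSq_congr_ae σ h]

end Congr

section Measurability

/-- The essential supremum is at most `c` exactly when the section of `{f > c}` is null, and the
measure of sections is a measurable function. -/
lemma measurable_essSup_prod {α β : Type*} [MeasurableSpace α] [MeasurableSpace β] {μ : Measure β}
    [SFinite μ] {f : α → β → ℝ≥0∞} (hf : Measurable (Function.uncurry f)) :
    Measurable fun a => essSup (f a) μ := by
  refine measurable_of_Iic fun c => ?_
  have h1 : (fun a => essSup (f a) μ) ⁻¹' Iic c =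
      {a | μ (Prod.mk a ⁻¹' {z : α × β | c < Function.uncurry f z}) = 0} := by
    ext a
    simp only [mem_preimage, mem_Iic, mem_ofPred_eq]
    constructor
    · intro h
      have h2 : ∀ᵐ b ∂μ, ¬ c < f a b := by
        filter_upwards [ENNReal.ae_le_essSup (μ := μ) (f a)] with b hb
        exact not_lt.2 (hb.trans h)
      rw [ae_iff] at h2
      simpa using h2
    · intro h
      refine essSup_le_of_ae_le _ ?_
      rw [Filter.EventuallyLE, ae_iff]
      simpa using h
  rw [h1]
  exact measurable_measure_prodMk_left (measurableSet_lt measurable_const hf)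
    (measurableSet_singleton 0)

variable {V : Type*} [NormedAddCommGroup V] [MeasurableSpace V] [BorelSpace V]
  [SecondCountableTopology V] {E : Type*} [NormedAddCommGroup E]

lemma measurable_slobIntegrand {u : V → E} (hu : StronglyMeasurable u) (c : ℝ) :
    Measurable fun z : V × V => ‖u z.1 - u z.2‖ₑ ^ 2 / ‖z.1 - z.2‖ₑ ^ c := by
  have h1 : Measurable fun z : V × V => ‖u z.1 - u z.2‖ₑ :=
    ((hu.comp_measurable measurable_fst).sub (hu.comp_measurable measurable_snd)).enorm
  have h2 : Measurable fun z : V × V => ‖z.1 - z.2‖ₑ := by fun_prop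
  exact (h1.pow_const 2).div (h2.pow_const c)

lemma lintegral_lintegral_lintegral_swap {α β : Type*} [MeasurableSpace α] [MeasurableSpace β]
    (ν : Measure α) [SFinite ν] (μ : Measure β) [SFinite μ] {Φ : α → α → β → ℝ≥0∞}
    (hΦ : Measurable fun z : (α × α) × β => Φ z.1.1 z.1.2 z.2) :
    ∫⁻ x, ∫⁻ t, ∫⁻ s, Φ t s x ∂ν ∂ν ∂μ = ∫⁻ z, ∫⁻ x, Φ z.1 z.2 x ∂μ ∂(ν.prod ν) := by
  calc _ = ∫⁻ x, ∫⁻ z, Φ z.1 z.2 x ∂(ν.prod ν) ∂μ := lintegral_congr fun x =>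
        (lintegral_prod _ (hΦ.comp measurable_prodMk_right).aemeasurable).symm
    _ = _ := lintegral_lintegral_swap (hΦ.comp measurable_swap).aemeasurable

end Measurability

/-! ### A priori bounds for a single factor. -/

/-- The a priori bounds of a function in `H^{l+1, (l+1)/2}` which enter the product estimate. -/
structure ParabolicBound {E : Type*} [NormedAddCommGroup E] [NormedSpace ℝ E] (l p T : ℝ)
    (Ω : Set R3) (f : ℝ → R3 → E) (M : ℝ → ℝ≥0∞) (K : ℝ≥0∞) : Prop where
  meas : StronglyMeasurable (Function.uncurry f)
  measM : Measurable M
  ae_le : ∀ᵐ t ∂(volume.restrict (Ioo 0 T)), ∀ᵐ x ∂(volume.restrict Ω), ‖f t x‖ₑ ≤ M t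
  lintegral_le : ∫⁻ t in Ioo 0 T, M t ^ 2 ≤ K
  lp_le : ∀ᵐ t ∂(volume.restrict (Ioo 0 T)), (∫⁻ x in Ω, ‖f t x‖ₑ ^ p) ^ (2 / p) ≤ K
  slob_le : ∀ᵐ t ∂(volume.restrict (Ioo 0 T)), slobSq l Ω (f t) ≤ K
  time_le : ∫⁻ x in Ω, slobSeminormSq ((l + 1) / 2) (Ioo 0 T) (fun t => f t x) ≤ K

section Product

variable {E : Type*} [NormedAddCommGroup E] [NormedSpace ℝ E]
variable {l p T : ℝ} {Ω : Set R3}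

lemma ae_ae_swap {α β : Type*} [MeasurableSpace α] [MeasurableSpace β] {μ : Measure α}
    {ν : Measure β} [SFinite μ] [SFinite ν] {P : α × β → Prop} (h : ∀ᵐ z ∂(μ.prod ν), P z) :
    ∀ᵐ y ∂ν, ∀ᵐ x ∂μ, P (x, y) :=
  Measure.ae_ae_of_ae_prod (Measure.measurePreserving_swap.quasiMeasurePreserving.ae h)

/-- A strongly measurable representative is chosen so that Tonelli's theorem is available later; the
seminorms do not see the change. The bounds uniform in time come from the essential supremum in
`normH`. -/
lemma exists_parabolicBound [CompleteSpace E] (hΩm : MeasurableSet Ω) {e : R3}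
    (hΩ : ContainsCone Ω e) (hl : 1 / 2 < l) (hp : 2 < p) (hpl : 3 / 2 - 3 / p ≤ l) :
    ∃ C : ℝ≥0, ∀ (T : ℝ) (F : ℝ → R3 → E), MemH l T Ω F → ∃ f M,
      Function.uncurry F =ᵐ[(volume.restrict (Ioo 0 T)).prod (volume.restrict Ω)]
        Function.uncurry f ∧ ParabolicBound l p T Ω f M (C * normH l T Ω F ^ 2) := by
  obtain ⟨C₁, hC₁⟩ := essSup_sq_le_slobOneSq (E := E) hΩm hΩ hl
  obtain ⟨C₂, hC₂⟩ := lintegral_rpow_le_slobSq (E := E) hΩm hΩ (by linarith : 0 < l) hp hpl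
  refine ⟨1 + C₁ + C₂, fun T F hF => ?_⟩
  have hN : normH l T Ω F ^ 2 = parOneSq l T Ω F +
      essSup (fun t => slobSq l Ω (F t)) (volume.restrict (Ioo 0 T)) := by
    rw [normH, ← ENNReal.rpow_natCast, ← ENNReal.rpow_mul]; simp
  rw [hN]
  set N := parOneSq l T Ω F + essSup (fun t => slobSq l Ω (F t)) (volume.restrict (Ioo 0 T))
  have h1N : N ≤ ((1 + C₁ + C₂ : ℝ≥0) : ℝ≥0∞) * N := by
    refine le_mul_of_one_le_left zero_le ?_
    push_cast; rw [add_assoc]; exact le_self_add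
  have hC₁N : C₁ * N ≤ ((1 + C₁ + C₂ : ℝ≥0) : ℝ≥0∞) * N := by
    gcongr; rw [add_comm 1, add_assoc]; exact le_self_add
  have hC₂N : C₂ * N ≤ ((1 + C₁ + C₂ : ℝ≥0) : ℝ≥0∞) * N := by
    gcongr; exact le_add_self
  set f : ℝ → R3 → E := fun t x => hF.1.mk _ (t, x) with hf
  have hae : Function.uncurry F =ᵐ[(volume.restrict (Ioo 0 T)).prod (volume.restrict Ω)]
      Function.uncurry f := hF.1.ae_eq_mk
  have hfm : StronglyMeasurable (Function.uncurry f) := hF.1.stronglyMeasurable_mk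
  have haet : ∀ᵐ t ∂(volume.restrict (Ioo 0 T)), F t =ᵐ[volume.restrict Ω] f t :=
    Measure.ae_ae_of_ae_prod hae
  have haex : ∀ᵐ x ∂(volume.restrict Ω),
      (fun t => F t x) =ᵐ[volume.restrict (Ioo 0 T)] fun t => f t x := ae_ae_swap hae
  have hslob : ∀ᵐ t ∂(volume.restrict (Ioo 0 T)), slobSq l Ω (f t) ≤ N := by
    filter_upwards [haet, ENNReal.ae_le_essSup (μ := volume.restrict (Ioo 0 T))
      (fun t => slobSq l Ω (F t))] with t ht h
    rw [← slobSq_congr_ae l ht]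
    exact h.trans le_add_self
  -- The spatial essential supremum is measurable in `t`. The infimum `slobOneSq` only majorises its
  -- square under the integral, so no measurability in `t` is asked of it.
  refine ⟨f, fun t => essSup (fun x => ‖f t x‖ₑ) (volume.restrict Ω), hae, hfm, ?_, ?_, ?_, ?_,
    ?_, ?_⟩
  · exact measurable_essSup_prod hfm.enorm
  · exact Filter.Eventually.of_forall fun t => ENNReal.ae_le_essSup _
  · refine le_trans ?_ hC₁N
    calc _ ≤ ∫⁻ t in Ioo 0 T, C₁ * slobOneSq l Ω (F t) := by
          refine lintegral_mono_ae ?_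
          filter_upwards [haet] with t ht
          rw [← essSup_congr_ae (ht.mono fun x hx => by simp only [hx] :
            (fun x => ‖F t x‖ₑ) =ᵐ[volume.restrict Ω] fun x => ‖f t x‖ₑ)]
          exact hC₁ (F t)
      _ ≤ _ := by
          rw [lintegral_const_mul' _ _ ENNReal.coe_ne_top]
          gcongr
          exact le_self_add.trans le_self_add
  · filter_upwards [hslob] with t ht
    refine (hC₂ (f t) (hfm.comp_measurable measurable_prodMk_left).aestronglyMeasurable).trans ?_
    exact le_trans (by gcongr) hC₂N
  · filter_upwards [hslob] with t ht using ht.trans h1N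
  · refine le_trans ?_ h1N
    calc _ ≤ ∫⁻ x in Ω, slobSq ((l + 1) / 2) (Ioo 0 T) (fun t => F t x) := by
          refine lintegral_mono_ae ?_
          filter_upwards [haex] with x hx
          rw [← slobSeminormSq_congr_ae _ hx]
          exact le_add_self
      _ ≤ N := le_add_self.trans le_self_add

variable {f : ℝ → R3 → E} {M : ℝ → ℝ≥0∞} {K : ℝ≥0∞}

lemma ParabolicBound.meas_slice (hf : ParabolicBound l p T Ω f M K) (t : ℝ) :
    StronglyMeasurable (f t) := hf.meas.comp_measurable measurable_prodMk_left

/-- `|f|⁴ ≤ M^(4-p) |f|^p`, and the integral of `|f|^p` over `Ω` is at most `K^(p/2)` for almost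
every time. As `4 - p < 2`, Hölder in time bounds the integral of `M^(4-p)` through that of `M²`,
with the gain `T^((p-2)/2)`. -/
lemma ParabolicBound.lintegral_pow_four_le (hf : ParabolicBound l p T Ω f M K) (hp : 2 < p)
    (hp4 : p < 4) :
    ∫⁻ t in Ioo 0 T, ∫⁻ x in Ω, ‖f t x‖ₑ ^ 4 ≤ ENNReal.ofReal T ^ ((p - 2) / 2) * K ^ 2 := by
  have hp0 : 0 < p := by linarith
  calc _ ≤ ∫⁻ t in Ioo 0 T, (M t ^ 2) ^ ((4 - p) / 2) * K ^ (p / 2) := by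
        refine lintegral_mono_ae ?_
        filter_upwards [hf.ae_le, hf.lp_le] with t h1 h2
        calc ∫⁻ x in Ω, ‖f t x‖ₑ ^ 4 ≤ ∫⁻ x in Ω, (M t ^ 2) ^ ((4 - p) / 2) * ‖f t x‖ₑ ^ p := by
              refine lintegral_mono_ae ?_
              filter_upwards [h1] with x hx
              rw [← ENNReal.rpow_natCast (M t), ← ENNReal.rpow_mul, ← ENNReal.rpow_natCast]
              calc ‖f t x‖ₑ ^ ((4 : ℕ) : ℝ) = ‖f t x‖ₑ ^ ((2 : ℕ) * ((4 - p) / 2)) * ‖f t x‖ₑ ^ p := by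
                    rw [← ENNReal.rpow_add_of_nonneg _ _ (by push_cast; linarith) hp0.le]
                    congr 1; push_cast; ring
                _ ≤ _ := by
                    gcongr
          _ = (M t ^ 2) ^ ((4 - p) / 2) * ∫⁻ x in Ω, ‖f t x‖ₑ ^ p :=
              lintegral_const_mul _ ((hf.meas_slice t).enorm.pow_const p)
          _ ≤ _ := by
              gcongr
              calc _ = ((∫⁻ x in Ω, ‖f t x‖ₑ ^ p) ^ (2 / p)) ^ (p / 2) := by
                    rw [← ENNReal.rpow_mul, show 2 / p * (p / 2) = 1 by field_simp,
                      ENNReal.rpow_one]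
                _ ≤ _ := by gcongr
    _ = (∫⁻ t in Ioo 0 T, (M t ^ 2) ^ ((4 - p) / 2) * 1 ^ ((p - 2) / 2)) * K ^ (p / 2) := by
        simp only [ENNReal.one_rpow, mul_one]
        exact lintegral_mul_const _ ((hf.measM.pow_const 2).pow_const _)
    _ ≤ (∫⁻ t in Ioo 0 T, M t ^ 2) ^ ((4 - p) / 2) * (∫⁻ t in Ioo 0 T, 1) ^ ((p - 2) / 2) *
          K ^ (p / 2) := by
        gcongr
        exact ENNReal.lintegral_mul_norm_pow_le (hf.measM.pow_const 2).aemeasurable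
          aemeasurable_const (by linarith) (by linarith) (by ring)
    _ ≤ K ^ ((4 - p) / 2) * ENNReal.ofReal T ^ ((p - 2) / 2) * K ^ (p / 2) := by
        gcongr
        · exact hf.lintegral_le
        · simp
    _ = _ := by
        have : K ^ ((4 - p) / 2) * K ^ (p / 2) = K ^ 2 := by
          rw [← ENNReal.rpow_add_of_nonneg _ _ (by linarith) (by linarith), ← ENNReal.rpow_natCast]
          congr 1; push_cast; ring
        rw [mul_right_comm, this, mul_comm]

end Product

/-! ### The time kernel, and the `L²` and spatial terms of the product. -/

section Product

/-- The integral of `|r| ^ (-κ)` over `(-T, T)`. -/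
noncomputable def kernelMass (κ T : ℝ) : ℝ≥0∞ := ∫⁻ r in Ioo (-T) T, ‖r‖ₑ ^ (-κ)

lemma kernelMass_mono (κ : ℝ) {S T : ℝ} (h : S ≤ T) : kernelMass κ S ≤ kernelMass κ T :=
  lintegral_mono_set (Ioo_subset_Ioo (neg_le_neg h) h)

lemma kernelMass_ne_top {κ : ℝ} (hκ : κ < 1) (T : ℝ) : kernelMass κ T ≠ ⊤ := by
  have h1 : ∫⁻ r in Ioo 0 T, ‖r‖ₑ ^ (-κ) < ⊤ := by
    have h := (intervalIntegral.intervalIntegrable_rpow' (a := 0) (b := T)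
      (by linarith : -1 < -κ)).1.mono_set Ioo_subset_Ioc_self
    refine lt_of_eq_of_lt (setLIntegral_congr_fun measurableSet_Ioo fun r hr => ?_) h.2
    simp only
    rw [Real.enorm_eq_ofReal hr.1.le, Real.enorm_eq_ofReal (Real.rpow_nonneg hr.1.le _),
      ENNReal.ofReal_rpow_of_pos hr.1]
  have h2 : ∫⁻ r in Ioo (-T) 0, ‖r‖ₑ ^ (-κ) = ∫⁻ r in Ioo 0 T, ‖r‖ₑ ^ (-κ) := by
    rw [← lintegral_indicator measurableSet_Ioo, ← lintegral_indicator measurableSet_Ioo,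
      ← lintegral_neg_eq_self]
    refine lintegral_congr fun r => ?_
    by_cases hr : r ∈ Ioo 0 T
    · rw [indicator_of_mem hr, indicator_of_mem (by simpa [and_comm] using hr), enorm_neg]
    · rw [indicator_of_notMem hr, indicator_of_notMem (by simpa [and_comm] using hr)]
  have hsub : Ioo (-T) T ⊆ (Ioo (-T) 0 ∪ {0}) ∪ Ioo 0 T := by
    intro r hr
    rcases lt_trichotomy r 0 with h | h | h
    · exact Or.inl (Or.inl ⟨hr.1, h⟩)
    · exact Or.inl (Or.inr h)
    · exact Or.inr ⟨h, hr.2⟩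
  refine ne_top_of_le_ne_top ?_ ((lintegral_mono_set hsub).trans ((lintegral_union_le _ _ _).trans
    (add_le_add_left (lintegral_union_le _ _ _) _)))
  rw [h2]
  simp [h1.ne]

lemma setLIntegral_sub_rpow_le (κ : ℝ) {T t : ℝ} (ht : t ∈ Ioo 0 T) :
    ∫⁻ s in Ioo 0 T, ‖t - s‖ₑ ^ (-κ) ≤ kernelMass κ T := by
  rw [kernelMass, ← lintegral_indicator measurableSet_Ioo, ← lintegral_indicator measurableSet_Ioo,
    ← lintegral_sub_left_eq_self ((Ioo (-T) T).indicator fun r => ‖r‖ₑ ^ (-κ)) t]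
  refine lintegral_mono fun s => ?_
  by_cases hs : s ∈ Ioo 0 T
  · have : t - s ∈ Ioo (-T) T := ⟨by linarith [hs.2, ht.1], by linarith [hs.1, ht.2]⟩
    rw [indicator_of_mem hs, indicator_of_mem this]
  · rw [indicator_of_notMem hs]; exact zero_le

variable {E₁ E₂ E₃ : Type*} [NormedAddCommGroup E₁] [NormedSpace ℝ E₁]
  [NormedAddCommGroup E₂] [NormedSpace ℝ E₂] [NormedAddCommGroup E₃] [NormedSpace ℝ E₃]
variable {l p T : ℝ} {Ω : Set R3} {f : ℝ → R3 → E₁} {g : ℝ → R3 → E₂} {M₁ M₂ : ℝ → ℝ≥0∞}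
  {K₁ K₂ : ℝ≥0∞}

lemma enorm_bilinear_le (mul : E₁ →L[ℝ] E₂ →L[ℝ] E₃) (a : E₁) (b : E₂) :
    ‖mul a b‖ₑ ≤ ‖mul‖ₑ * ‖a‖ₑ * ‖b‖ₑ :=
  ((mul a).le_opENorm b).trans (by gcongr; exact mul.le_opENorm a)

/-- In the splitting `ab - a'b' = a(b - b') + (a - a')b'` each undifferenced factor is evaluated at
a single point, so that a bound valid almost everywhere in that variable can be inserted. -/
lemma enorm_bilinear_sub_sq_le (mul : E₁ →L[ℝ] E₂ →L[ℝ] E₃) (a a' : E₁) (b b' : E₂) :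
    ‖mul a b - mul a' b'‖ₑ ^ 2 ≤
      2 * ‖mul‖ₑ ^ 2 * (‖a‖ₑ ^ 2 * ‖b - b'‖ₑ ^ 2 + ‖b'‖ₑ ^ 2 * ‖a - a'‖ₑ ^ 2) := by
  have h : mul a b - mul a' b' = mul a (b - b') + mul (a - a') b' := by simp
  calc _ ≤ (‖mul‖ₑ * ‖a‖ₑ * ‖b - b'‖ₑ + ‖mul‖ₑ * ‖a - a'‖ₑ * ‖b'‖ₑ) ^ 2 := by
        rw [h]
        gcongr
        exact (enorm_add_le _ _).trans (add_le_add (enorm_bilinear_le _ _ _)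
          (enorm_bilinear_le _ _ _))
    _ ≤ _ := ENNReal.add_sq_le_two_mul _ _
    _ = _ := by ring

/-- Cauchy–Schwarz in `x` and then in `t` reduces the claim to the fourth powers of the factors. -/
lemma lintegral_l2Sq_mul_le (mul : E₁ →L[ℝ] E₂ →L[ℝ] E₃) (hf : ParabolicBound l p T Ω f M₁ K₁)
    (hg : ParabolicBound l p T Ω g M₂ K₂) (hp : 2 < p) (hp4 : p < 4) :
    ∫⁻ t in Ioo 0 T, l2Sq Ω (fun x => mul (f t x) (g t x)) ≤
      ‖mul‖ₑ ^ 2 * (ENNReal.ofReal T ^ ((p - 2) / 2) * (K₁ * K₂)) := by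
  have hhalf : ∀ a : ℝ≥0∞, (a ^ 4) ^ (1 / 2 : ℝ) = a ^ 2 := fun a => by
    rw [← ENNReal.rpow_natCast, ← ENNReal.rpow_mul, ← ENNReal.rpow_natCast]; norm_num
  have hhalf' : ∀ a : ℝ≥0∞, (a ^ 2) ^ (1 / 2 : ℝ) = a := fun a => by
    rw [← ENNReal.rpow_natCast, ← ENNReal.rpow_mul]; norm_num
  have hX : Measurable fun t => ∫⁻ x in Ω, ‖f t x‖ₑ ^ 4 :=
    (hf.meas.enorm.pow_const 4).lintegral_prod_right'
  have hY : Measurable fun t => ∫⁻ x in Ω, ‖g t x‖ₑ ^ 4 :=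
    (hg.meas.enorm.pow_const 4).lintegral_prod_right'
  calc _ ≤ ∫⁻ t in Ioo 0 T, ‖mul‖ₑ ^ 2 * ((∫⁻ x in Ω, ‖f t x‖ₑ ^ 4) ^ (1 / 2 : ℝ) *
          (∫⁻ x in Ω, ‖g t x‖ₑ ^ 4) ^ (1 / 2 : ℝ)) := by
        refine lintegral_mono fun t => ?_
        calc _ ≤ ∫⁻ x in Ω, ‖mul‖ₑ ^ 2 *
              ((‖f t x‖ₑ ^ 4) ^ (1 / 2 : ℝ) * (‖g t x‖ₑ ^ 4) ^ (1 / 2 : ℝ)) := by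
              refine lintegral_mono fun x => ?_
              rw [hhalf, hhalf, ← mul_pow, ← mul_pow, ← mul_assoc]
              gcongr
              exact enorm_bilinear_le _ _ _
          _ = _ := lintegral_const_mul' _ _ (by simp)
          _ ≤ _ := by
              gcongr
              exact ENNReal.lintegral_mul_norm_pow_le
                ((hf.meas_slice t).enorm.pow_const 4).aemeasurable
                ((hg.meas_slice t).enorm.pow_const 4).aemeasurable
                (by norm_num) (by norm_num) (by norm_num)
    _ = ‖mul‖ₑ ^ 2 * ∫⁻ t in Ioo 0 T, ((∫⁻ x in Ω, ‖f t x‖ₑ ^ 4) ^ (1 / 2 : ℝ) *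
          (∫⁻ x in Ω, ‖g t x‖ₑ ^ 4) ^ (1 / 2 : ℝ)) := lintegral_const_mul' _ _ (by simp)
    _ ≤ ‖mul‖ₑ ^ 2 * ((ENNReal.ofReal T ^ ((p - 2) / 2) * K₁ ^ 2) ^ (1 / 2 : ℝ) *
          (ENNReal.ofReal T ^ ((p - 2) / 2) * K₂ ^ 2) ^ (1 / 2 : ℝ)) := by
        gcongr
        refine (ENNReal.lintegral_mul_norm_pow_le hX.aemeasurable hY.aemeasurable
                (by norm_num) (by norm_num) (by norm_num)).trans ?_
        gcongr
        · exact hf.lintegral_pow_four_le hp hp4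
        · exact hg.lintegral_pow_four_le hp hp4
    _ = _ := by
        rw [← ENNReal.mul_rpow_of_nonneg _ _ (by norm_num)]
        congr 1
        rw [← hhalf' (ENNReal.ofReal T ^ ((p - 2) / 2) * (K₁ * K₂))]
        congr 1
        ring

lemma lintegral_const_mul_add {α : Type*} [MeasurableSpace α] {μ : Measure α} {Φ Ψ : α → ℝ≥0∞}
    (hΦ : Measurable Φ) (hΨ : Measurable Ψ) {c : ℝ≥0∞} (hc : c ≠ ⊤) (a b : ℝ≥0∞) :
    ∫⁻ x, c * (a * Φ x + b * Ψ x) ∂μ = c * (a * ∫⁻ x, Φ x ∂μ + b * ∫⁻ x, Ψ x ∂μ) := by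
  rw [lintegral_const_mul' _ _ hc, lintegral_add_left (hΦ.const_mul _), lintegral_const_mul _ hΦ,
    lintegral_const_mul _ hΨ]

lemma lintegral_lintegral_const_mul_add {α : Type*} [MeasurableSpace α] {μ : Measure α} [SFinite μ]
    {Φ Ψ : α × α → ℝ≥0∞} (hΦ : Measurable Φ) (hΨ : Measurable Ψ) {c : ℝ≥0∞} (hc : c ≠ ⊤)
    (a b : ℝ≥0∞) :
    ∫⁻ x, ∫⁻ y, c * (a * Φ (x, y) + b * Ψ (x, y)) ∂μ ∂μ =
      c * (a * ∫⁻ x, ∫⁻ y, Φ (x, y) ∂μ ∂μ + b * ∫⁻ x, ∫⁻ y, Ψ (x, y) ∂μ ∂μ) := by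
  rw [← lintegral_const_mul_add hΦ.lintegral_prod_right' hΨ.lintegral_prod_right' hc]
  exact lintegral_congr fun x => lintegral_const_mul_add (hΦ.comp measurable_prodMk_left)
    (hΨ.comp measurable_prodMk_left) hc a b

lemma slobSeminormSq_mul_le (mul : E₁ →L[ℝ] E₂ →L[ℝ] E₃) (σ : ℝ) {u : R3 → E₁} {w : R3 → E₂}
    (hu : StronglyMeasurable u) (hw : StronglyMeasurable w) {a b : ℝ≥0∞}
    (hua : ∀ᵐ x ∂(volume.restrict Ω), ‖u x‖ₑ ≤ a) (hwb : ∀ᵐ x ∂(volume.restrict Ω), ‖w x‖ₑ ≤ b) :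
    slobSeminormSq σ Ω (fun x => mul (u x) (w x)) ≤ 2 * ‖mul‖ₑ ^ 2 *
      (a ^ 2 * slobSeminormSq σ Ω w + b ^ 2 * slobSeminormSq σ Ω u) := by
  refine le_trans ?_ (lintegral_lintegral_const_mul_add
    (measurable_slobIntegrand hw ((Module.finrank ℝ R3 : ℝ) + 2 * σ))
    (measurable_slobIntegrand hu ((Module.finrank ℝ R3 : ℝ) + 2 * σ))
    (ENNReal.mul_ne_top (by simp) (by simp)) (a ^ 2) (b ^ 2)).le
  refine lintegral_mono_ae (hua.mono fun x hx => lintegral_mono_ae (hwb.mono fun y hy => ?_))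
  rw [← mul_div_assoc, ← mul_div_assoc, ← ENNReal.add_div, ← mul_div_assoc]
  refine ENNReal.div_le_div_right ((enorm_bilinear_sub_sq_le mul _ _ _ _).trans ?_) _
  exact mul_le_mul' le_rfl (add_le_add (mul_le_mul' (pow_le_pow_left' hx 2) le_rfl)
    (mul_le_mul' (pow_le_pow_left' hy 2) le_rfl))

lemma lintegral_slobSeminormSq_mul_le (mul : E₁ →L[ℝ] E₂ →L[ℝ] E₃)
    (hf : ParabolicBound l p T Ω f M₁ K₁) (hg : ParabolicBound l p T Ω g M₂ K₂) :
    ∫⁻ t in Ioo 0 T, slobSeminormSq l Ω (fun x => mul (f t x) (g t x)) ≤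
      4 * ‖mul‖ₑ ^ 2 * (K₁ * K₂) := by
  calc _ ≤ ∫⁻ t in Ioo 0 T, 2 * ‖mul‖ₑ ^ 2 * (K₂ * M₁ t ^ 2 + K₁ * M₂ t ^ 2) := by
        refine lintegral_mono_ae ?_
        filter_upwards [hf.ae_le, hg.ae_le, hf.slob_le, hg.slob_le] with t hf1 hg1 hf2 hg2
        refine (slobSeminormSq_mul_le mul l (hf.meas_slice t) (hg.meas_slice t) hf1 hg1).trans ?_
        rw [mul_comm K₂, mul_comm K₁]
        exact mul_le_mul' le_rfl (add_le_add (mul_le_mul' le_rfl (le_add_self.trans hg2))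
          (mul_le_mul' le_rfl (le_add_self.trans hf2)))
    _ = 2 * ‖mul‖ₑ ^ 2 * (K₂ * (∫⁻ t in Ioo 0 T, M₁ t ^ 2) +
          K₁ * ∫⁻ t in Ioo 0 T, M₂ t ^ 2) :=
        lintegral_const_mul_add (hf.measM.pow_const 2) (hg.measM.pow_const 2)
          (ENNReal.mul_ne_top (by simp) (by simp)) _ _
    _ ≤ 2 * ‖mul‖ₑ ^ 2 * (K₂ * K₁ + K₁ * K₂) :=
        mul_le_mul' le_rfl (add_le_add (mul_le_mul' le_rfl hf.lintegral_le)
          (mul_le_mul' le_rfl hg.lintegral_le))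
    _ = _ := by ring

end Product

/-! ### The time seminorm of the product. -/

section Product

variable {E₁ E₂ E₃ : Type*} [NormedAddCommGroup E₁] [NormedSpace ℝ E₁]
  [NormedAddCommGroup E₂] [NormedSpace ℝ E₂] [NormedAddCommGroup E₃] [NormedSpace ℝ E₃]
variable {l p T : ℝ} {Ω : Set R3} {f : ℝ → R3 → E₁} {g : ℝ → R3 → E₂} {M₁ M₂ : ℝ → ℝ≥0∞}
  {K₁ K₂ : ℝ≥0∞}

/-- Interpolation between `L²` and `L^∞` for the second factor. -/
lemma lintegral_sq_mul_sq_le {α : Type*} [MeasurableSpace α] {μ : Measure α} {a d : α → ℝ≥0∞}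
    (ha : Measurable a) (hd : Measurable d) (hp : 2 < p) {m : ℝ≥0∞} (hdm : ∀ᵐ x ∂μ, d x ≤ m) :
    ∫⁻ x, a x ^ 2 * d x ^ 2 ∂μ ≤
      (m ^ 2) ^ (2 / p) * ((∫⁻ x, a x ^ p ∂μ) ^ (2 / p) * (∫⁻ x, d x ^ 2 ∂μ) ^ (1 - 2 / p)) := by
  have hp0 : 0 < p := by linarith
  have hθ : 2 / p ≤ 1 := by rw [div_le_one hp0]; exact hp.le
  have hθ0 : 0 ≤ 2 / p := by positivity
  calc _ ≤ ∫⁻ x, (m ^ 2) ^ (2 / p) * ((a x ^ p) ^ (2 / p) * (d x ^ 2) ^ (1 - 2 / p)) ∂μ := by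
        refine lintegral_mono_ae (hdm.mono fun x hx => ?_)
        have h1 : (a x ^ p) ^ (2 / p) = a x ^ 2 := by
          rw [← ENNReal.rpow_mul, show p * (2 / p) = (2 : ℕ) by field_simp; norm_num,
            ENNReal.rpow_natCast]
        have h2 : d x ^ 2 = (d x ^ 2) ^ (2 / p) * (d x ^ 2) ^ (1 - 2 / p) := by
          rw [← ENNReal.rpow_add_of_nonneg _ _ hθ0 (by linarith)]
          simp
        calc a x ^ 2 * d x ^ 2 = a x ^ 2 * ((d x ^ 2) ^ (2 / p) * (d x ^ 2) ^ (1 - 2 / p)) := by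
              rw [← h2]
          _ ≤ a x ^ 2 * ((m ^ 2) ^ (2 / p) * (d x ^ 2) ^ (1 - 2 / p)) := by gcongr
          _ = _ := by rw [h1]; ring
    _ = (m ^ 2) ^ (2 / p) * ∫⁻ x, (a x ^ p) ^ (2 / p) * (d x ^ 2) ^ (1 - 2 / p) ∂μ := by
        have : Measurable fun x => (a x ^ p) ^ (2 / p) * (d x ^ 2) ^ (1 - 2 / p) :=
          ((ha.pow_const p).pow_const _).mul ((hd.pow_const 2).pow_const _)
        exact lintegral_const_mul _ this
    _ ≤ _ := by
        gcongr
        exact ENNReal.lintegral_mul_norm_pow_le (ha.pow_const p).aemeasurable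
          (hd.pow_const 2).aemeasurable hθ0 (by linarith) (by ring)

/-- Splits the singular weight between the two factors of a Hölder inequality with exponents `θ` and
`1 - θ`. -/
lemma ENNReal.interpolate_div {θ a b r : ℝ} {A D R : ℝ≥0∞} (hθ0 : 0 ≤ θ) (hθ1 : θ ≤ 1)
    (hR0 : R ≠ 0) (hRt : R ≠ ⊤) (hab : a * θ + b * (1 - θ) = r) :
    A ^ θ * D ^ (1 - θ) / R ^ r = (A / R ^ a) ^ θ * (D / R ^ b) ^ (1 - θ) := by
  have h : (R ^ r)⁻¹ = (R ^ (a * θ))⁻¹ * (R ^ (b * (1 - θ)))⁻¹ := by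
    rw [← ENNReal.rpow_neg, ← ENNReal.rpow_neg, ← ENNReal.rpow_neg, ← ENNReal.rpow_add _ _ hR0 hRt,
      ← hab]
    congr 1; ring
  rw [ENNReal.div_rpow_of_nonneg _ _ hθ0, ENNReal.div_rpow_of_nonneg _ _ (by linarith),
    ← ENNReal.rpow_mul, ← ENNReal.rpow_mul, div_eq_mul_inv, div_eq_mul_inv, div_eq_mul_inv, h]
  ring

lemma ae_fst_of_ae {α : Type*} [MeasurableSpace α] {ν : Measure α} [SFinite ν] {P : α → Prop}
    (h : ∀ᵐ t ∂ν, P t) : ∀ᵐ z ∂(ν.prod ν), P z.1 :=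
  Measure.quasiMeasurePreserving_fst.ae h

lemma ae_snd_of_ae {α : Type*} [MeasurableSpace α] {ν : Measure α} [SFinite ν] {P : α → Prop}
    (h : ∀ᵐ t ∂ν, P t) : ∀ᵐ z ∂(ν.prod ν), P z.2 :=
  Measure.quasiMeasurePreserving_snd.ae h

lemma ParabolicBound.meas_diff (hg : ParabolicBound l p T Ω g M₂ K₂) :
    Measurable fun w : (ℝ × ℝ) × R3 => ‖g w.1.1 w.2 - g w.1.2 w.2‖ₑ :=
  ((hg.meas.comp_measurable (g := fun w : (ℝ × ℝ) × R3 => (w.1.1, w.2)) (by fun_prop)).sub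
    (hg.meas.comp_measurable (g := fun w : (ℝ × ℝ) × R3 => (w.1.2, w.2)) (by fun_prop))).enorm

lemma measurable_dist_rpow (c : ℝ) : Measurable fun z : ℝ × ℝ => ‖z.1 - z.2‖ₑ ^ c :=
  Measurable.pow_const (by fun_prop) c

lemma ParabolicBound.lintegral_diff_div_le (hg : ParabolicBound l p T Ω g M₂ K₂) :
    ∫⁻ z, (∫⁻ x in Ω, ‖g z.1 x - g z.2 x‖ₑ ^ 2) / ‖z.1 - z.2‖ₑ ^ (2 + l)
      ∂((volume.restrict (Ioo 0 T)).prod (volume.restrict (Ioo 0 T))) ≤ K₂ := by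
  refine le_trans (le_of_eq ?_) hg.time_le
  simp only [slobSeminormSq]
  have hm := hg.meas_diff
  have hd : Measurable fun w : (ℝ × ℝ) × R3 =>
      ‖w.1.1 - w.1.2‖ₑ ^ ((Module.finrank ℝ ℝ : ℝ) + 2 * ((l + 1) / 2)) :=
    (measurable_dist_rpow _).comp measurable_fst
  rw [lintegral_lintegral_lintegral_swap (volume.restrict (Ioo 0 T)) (volume.restrict Ω)
    (Φ := fun t s x => ‖g t x - g s x‖ₑ ^ 2 /
      ‖t - s‖ₑ ^ ((Module.finrank ℝ ℝ : ℝ) + 2 * ((l + 1) / 2))) ((hm.pow_const 2).div hd)]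
  refine lintegral_congr fun z => ?_
  have hexp : (Module.finrank ℝ ℝ : ℝ) + 2 * ((l + 1) / 2) = 2 + l := by
    rw [Module.finrank_self]; push_cast; ring
  have hmz : Measurable fun x => ‖g z.1 x - g z.2 x‖ₑ ^ 2 :=
    (hm.comp (measurable_prodMk_left (x := z))).pow_const 2
  rw [hexp]
  simp only [div_eq_mul_inv]
  rw [lintegral_mul_const _ hmz]

/-- `M₂` depends on one time only, so the kernel can be integrated in the other time first, giving
at most `kernelMass κ T`. -/
lemma ParabolicBound.lintegral_fst_div_le (hg : ParabolicBound l p T Ω g M₂ K₂) (κ : ℝ) :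
    ∫⁻ z, M₂ z.1 ^ 2 / ‖z.1 - z.2‖ₑ ^ κ
      ∂((volume.restrict (Ioo 0 T)).prod (volume.restrict (Ioo 0 T))) ≤ kernelMass κ T * K₂ := by
  have h1 : Measurable fun z : ℝ × ℝ => M₂ z.1 ^ 2 := (hg.measM.comp measurable_fst).pow_const 2
  have h3 : Measurable fun z : ℝ × ℝ => M₂ z.1 ^ 2 / ‖z.1 - z.2‖ₑ ^ κ :=
    h1.div (measurable_dist_rpow κ)
  rw [lintegral_prod _ h3.aemeasurable]
  calc _ ≤ ∫⁻ t in Ioo 0 T, kernelMass κ T * M₂ t ^ 2 := by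
        refine setLIntegral_mono' measurableSet_Ioo fun t ht => ?_
        have h2 : Measurable fun s => ‖t - s‖ₑ ^ (-κ) :=
          (measurable_dist_rpow (-κ)).comp measurable_prodMk_left
        simp only [div_eq_mul_inv, ← ENNReal.rpow_neg]
        rw [lintegral_const_mul _ h2, mul_comm]
        gcongr
        exact setLIntegral_sub_rpow_le κ ht
    _ = kernelMass κ T * ∫⁻ t in Ioo 0 T, M₂ t ^ 2 :=
        lintegral_const_mul _ (hg.measM.pow_const 2)
    _ ≤ _ := by gcongr; exact hg.lintegral_le

lemma ParabolicBound.lintegral_snd_div_le (hg : ParabolicBound l p T Ω g M₂ K₂) (κ : ℝ) :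
    ∫⁻ z, M₂ z.2 ^ 2 / ‖z.1 - z.2‖ₑ ^ κ
      ∂((volume.restrict (Ioo 0 T)).prod (volume.restrict (Ioo 0 T))) ≤ kernelMass κ T * K₂ := by
  rw [← lintegral_prod_swap]
  refine (lintegral_congr fun z => ?_).trans_le (hg.lintegral_fst_div_le κ)
  simp only [Prod.fst_swap, Prod.snd_swap]
  rw [← enorm_neg (z.2 - z.1), neg_sub]

lemma ParabolicBound.lintegral_add_div_le (hg : ParabolicBound l p T Ω g M₂ K₂) (κ : ℝ) :
    ∫⁻ z, (M₂ z.1 + M₂ z.2) ^ 2 / ‖z.1 - z.2‖ₑ ^ κ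
      ∂((volume.restrict (Ioo 0 T)).prod (volume.restrict (Ioo 0 T))) ≤
        4 * kernelMass κ T * K₂ := by
  have h1 : Measurable fun z : ℝ × ℝ => M₂ z.1 ^ 2 / ‖z.1 - z.2‖ₑ ^ κ :=
    ((hg.measM.comp measurable_fst).pow_const 2).div (measurable_dist_rpow κ)
  calc _ ≤ ∫⁻ z, 2 * (M₂ z.1 ^ 2 / ‖z.1 - z.2‖ₑ ^ κ + M₂ z.2 ^ 2 / ‖z.1 - z.2‖ₑ ^ κ)
      ∂((volume.restrict (Ioo 0 T)).prod (volume.restrict (Ioo 0 T))) := by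
        refine lintegral_mono fun z => ?_
        rw [← ENNReal.add_div, ← mul_div_assoc]
        gcongr
        exact ENNReal.add_sq_le_two_mul _ _
    _ ≤ 2 * (kernelMass κ T * K₂ + kernelMass κ T * K₂) := by
        rw [lintegral_const_mul' _ _ (by simp), lintegral_add_left h1]
        gcongr
        · exact hg.lintegral_fst_div_le κ
        · exact hg.lintegral_snd_div_le κ
    _ = _ := by ring

lemma lintegral_time_difference_le (hf : ParabolicBound l p T Ω f M₁ K₁)
    (hg : ParabolicBound l p T Ω g M₂ K₂) (hp : 2 < p) :
    ∫⁻ z, (∫⁻ x in Ω, ‖f z.1 x‖ₑ ^ 2 * ‖g z.1 x - g z.2 x‖ₑ ^ 2) / ‖z.1 - z.2‖ₑ ^ (1 + l)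
      ∂((volume.restrict (Ioo 0 T)).prod (volume.restrict (Ioo 0 T))) ≤
        (4 * kernelMass (2 + l - p / 2) T) ^ (2 / p) * (K₁ * K₂) := by
  have hp0 : 0 < p := by linarith
  have hθ1 : 2 / p ≤ 1 := by rw [div_le_one hp0]; exact hp.le
  have hθ0 : 0 ≤ 2 / p := by positivity
  -- Fixed by `κ * (2/p) + (2 + l) * (1 - 2/p) = 1 + l`, where `2 + l` is the weight of the time
  -- seminorm of order `(l + 1) / 2`. The kernel is integrable when `κ < 1`, that is `p > 2 + 2 *
  -- l`.
  set κ := 2 + l - p / 2 with hκ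
  set ν := volume.restrict (Ioo 0 T)
  set A : ℝ × ℝ → ℝ≥0∞ := fun z => (M₂ z.1 + M₂ z.2) ^ 2 / ‖z.1 - z.2‖ₑ ^ κ
  set D : ℝ × ℝ → ℝ≥0∞ := fun z =>
    (∫⁻ x in Ω, ‖g z.1 x - g z.2 x‖ₑ ^ 2) / ‖z.1 - z.2‖ₑ ^ (2 + l)
  have hAm : Measurable A :=
    (((hg.measM.comp measurable_fst).add (hg.measM.comp measurable_snd)).pow_const 2).div
      (measurable_dist_rpow κ)
  have hDm : Measurable D :=
    ((hg.meas_diff.pow_const 2).lintegral_prod_right').div (measurable_dist_rpow (2 + l))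
  calc _ ≤ ∫⁻ z, K₁ * (A z ^ (2 / p) * D z ^ (1 - 2 / p)) ∂(ν.prod ν) := by
        refine lintegral_mono_ae ?_
        filter_upwards [ae_fst_of_ae hf.lp_le, ae_fst_of_ae hg.ae_le, ae_snd_of_ae hg.ae_le]
          with z hfp hg1 hg2
        -- On the diagonal the weight cannot be split, but there the numerator vanishes.
        rcases eq_or_ne ‖z.1 - z.2‖ₑ 0 with h0 | h0
        · have : z.1 = z.2 := by rwa [enorm_eq_zero, sub_eq_zero] at h0
          simp [this]
        have hm : ∀ᵐ x ∂(volume.restrict Ω), ‖g z.1 x - g z.2 x‖ₑ ≤ M₂ z.1 + M₂ z.2 := by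
          filter_upwards [hg1, hg2] with x h1 h2
          exact (enorm_sub_le).trans (add_le_add h1 h2)
        calc _ ≤ ((M₂ z.1 + M₂ z.2) ^ 2) ^ (2 / p) * (K₁ *
              (∫⁻ x in Ω, ‖g z.1 x - g z.2 x‖ₑ ^ 2) ^ (1 - 2 / p)) / ‖z.1 - z.2‖ₑ ^ (1 + l) := by
              refine ENNReal.div_le_div_right ((lintegral_sq_mul_sq_le (hf.meas_slice _).enorm
                ((hg.meas_slice _).sub (hg.meas_slice _)).enorm hp hm).trans ?_) _
              exact mul_le_mul' le_rfl (mul_le_mul' hfp le_rfl)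
          _ = K₁ * (((M₂ z.1 + M₂ z.2) ^ 2) ^ (2 / p) *
              (∫⁻ x in Ω, ‖g z.1 x - g z.2 x‖ₑ ^ 2) ^ (1 - 2 / p) / ‖z.1 - z.2‖ₑ ^ (1 + l)) := by
              simp only [div_eq_mul_inv]; ring
          _ = _ := by
              rw [ENNReal.interpolate_div (a := κ) (b := 2 + l) hθ0 hθ1 h0 enorm_ne_top
                (by rw [hκ]; field_simp; ring)]
    _ = K₁ * ∫⁻ z, A z ^ (2 / p) * D z ^ (1 - 2 / p) ∂(ν.prod ν) :=
        lintegral_const_mul _ ((hAm.pow_const _).mul (hDm.pow_const _))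
    _ ≤ K₁ * ((4 * kernelMass κ T * K₂) ^ (2 / p) * K₂ ^ (1 - 2 / p)) := by
        refine mul_le_mul' le_rfl ((ENNReal.lintegral_mul_norm_pow_le hAm.aemeasurable
          hDm.aemeasurable hθ0 (by linarith) (by ring)).trans (mul_le_mul' ?_ ?_))
        · exact ENNReal.rpow_le_rpow (hg.lintegral_add_div_le κ) hθ0
        · exact ENNReal.rpow_le_rpow hg.lintegral_diff_div_le (by linarith)
    _ = _ := by
        have : K₂ ^ (2 / p) * K₂ ^ (1 - 2 / p) = K₂ := by
          rw [← ENNReal.rpow_add_of_nonneg _ _ hθ0 (by linarith)]; simp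
        rw [ENNReal.mul_rpow_of_nonneg _ _ hθ0]
        calc _ = (4 * kernelMass κ T) ^ (2 / p) * (K₁ * (K₂ ^ (2 / p) * K₂ ^ (1 - 2 / p))) := by ring
          _ = _ := by rw [this]

lemma stronglyMeasurable_bilinear (mul : E₁ →L[ℝ] E₂ →L[ℝ] E₃)
    (hf : ParabolicBound l p T Ω f M₁ K₁) (hg : ParabolicBound l p T Ω g M₂ K₂) :
    StronglyMeasurable (Function.uncurry fun t x => mul (f t x) (g t x)) :=
  (mul.continuous₂.comp_stronglyMeasurable (hf.meas.prodMk hg.meas) :)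

lemma lintegral_slobSeminormSq_time_mul_le (mul : E₁ →L[ℝ] E₂ →L[ℝ] E₃)
    (hf : ParabolicBound l p T Ω f M₁ K₁) (hg : ParabolicBound l p T Ω g M₂ K₂) (hp : 2 < p) :
    ∫⁻ x in Ω, slobSeminormSq (l / 2) (Ioo 0 T) (fun t => mul (f t x) (g t x)) ≤
      4 * ‖mul‖ₑ ^ 2 * (4 * kernelMass (2 + l - p / 2) T) ^ (2 / p) * (K₁ * K₂) := by
  have hexp : (Module.finrank ℝ ℝ : ℝ) + 2 * (l / 2) = 1 + l := by
    rw [Module.finrank_self]; push_cast; ring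
  simp only [slobSeminormSq, hexp]
  set ν := volume.restrict (Ioo 0 T)
  have hb := stronglyMeasurable_bilinear mul hf hg
  have hbd : Measurable fun w : (ℝ × ℝ) × R3 =>
      ‖mul (f w.1.1 w.2) (g w.1.1 w.2) - mul (f w.1.2 w.2) (g w.1.2 w.2)‖ₑ :=
    ((hb.comp_measurable (g := fun w : (ℝ × ℝ) × R3 => (w.1.1, w.2)) (by fun_prop)).sub
      (hb.comp_measurable (g := fun w : (ℝ × ℝ) × R3 => (w.1.2, w.2)) (by fun_prop))).enorm
  have hd : Measurable fun w : (ℝ × ℝ) × R3 => ‖w.1.1 - w.1.2‖ₑ ^ (1 + l) :=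
    (measurable_dist_rpow (1 + l)).comp measurable_fst
  rw [lintegral_lintegral_lintegral_swap ν (volume.restrict Ω)
    (Φ := fun t s x => ‖mul (f t x) (g t x) - mul (f s x) (g s x)‖ₑ ^ 2 / ‖t - s‖ₑ ^ (1 + l))
    ((hbd.pow_const 2).div hd)]
  set P : ℝ × ℝ → ℝ≥0∞ := fun z =>
    (∫⁻ x in Ω, ‖f z.1 x‖ₑ ^ 2 * ‖g z.1 x - g z.2 x‖ₑ ^ 2) / ‖z.1 - z.2‖ₑ ^ (1 + l)
  set Q : ℝ × ℝ → ℝ≥0∞ := fun z =>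
    (∫⁻ x in Ω, ‖g z.1 x‖ₑ ^ 2 * ‖f z.1 x - f z.2 x‖ₑ ^ 2) / ‖z.1 - z.2‖ₑ ^ (1 + l)
  have hPm : Measurable P := by
    refine Measurable.div (Measurable.lintegral_prod_right' (f := fun w : (ℝ × ℝ) × R3 =>
      ‖f w.1.1 w.2‖ₑ ^ 2 * ‖g w.1.1 w.2 - g w.1.2 w.2‖ₑ ^ 2) ?_) (measurable_dist_rpow (1 + l))
    exact ((hf.meas.comp_measurable (g := fun w : (ℝ × ℝ) × R3 => (w.1.1, w.2))
      (by fun_prop)).enorm.pow_const 2).mul (hg.meas_diff.pow_const 2)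
  -- The second term of the splitting has `g` at the later variable `z.2`. Reading it at the swapped
  -- point turns it into `P` with `f` and `g` exchanged, and the product measure is invariant under
  -- the swap.
  calc _ ≤ ∫⁻ z, 2 * ‖mul‖ₑ ^ 2 * (P z + Q z.swap) ∂(ν.prod ν) := by
        refine lintegral_mono fun z => ?_
        have m1 : Measurable fun x => ‖f z.1 x‖ₑ ^ 2 * ‖g z.1 x - g z.2 x‖ₑ ^ 2 :=
          ((hf.meas_slice _).enorm.pow_const 2).mul
            (((hg.meas_slice _).sub (hg.meas_slice _)).enorm.pow_const 2)
        simp only [P, Q, Prod.fst_swap, Prod.snd_swap]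
        rw [← enorm_neg (z.2 - z.1), neg_sub, ← ENNReal.add_div, ← lintegral_add_left m1,
          ← mul_div_assoc, ← lintegral_const_mul' _ _ (ENNReal.mul_ne_top (by simp) (by simp))]
        have m2 : Measurable fun x =>
            ‖mul (f z.1 x) (g z.1 x) - mul (f z.2 x) (g z.2 x)‖ₑ ^ 2 :=
          (hbd.comp (measurable_prodMk_left (x := z))).pow_const 2
        simp only [div_eq_mul_inv]
        rw [lintegral_mul_const _ m2]
        refine mul_le_mul' (lintegral_mono fun x => ?_) le_rfl
        refine (enorm_bilinear_sub_sq_le mul _ _ _ _).trans_eq ?_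
        rw [← enorm_neg (f z.2 x - f z.1 x), neg_sub]
    _ = 2 * ‖mul‖ₑ ^ 2 * ((∫⁻ z, P z ∂(ν.prod ν)) + ∫⁻ z, Q z ∂(ν.prod ν)) := by
        rw [lintegral_const_mul' _ _ (ENNReal.mul_ne_top (by simp) (by simp)),
          lintegral_add_left hPm, lintegral_prod_swap]
    _ ≤ 2 * ‖mul‖ₑ ^ 2 * ((4 * kernelMass (2 + l - p / 2) T) ^ (2 / p) * (K₁ * K₂) +
          (4 * kernelMass (2 + l - p / 2) T) ^ (2 / p) * (K₂ * K₁)) :=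
        mul_le_mul' le_rfl (add_le_add (lintegral_time_difference_le hf hg hp)
          (lintegral_time_difference_le hg hf hp))
    _ = _ := by ring

end Product

/-! ### Assembly and dependence of the constant on `T`. -/

lemma normQ_congr_ae {E : Type*} [NormedAddCommGroup E] [NormedSpace ℝ E] (l T : ℝ) (Ω : Set R3)
    {u v : ℝ → R3 → E}
    (h : Function.uncurry u =ᵐ[(volume.restrict (Ioo 0 T)).prod (volume.restrict Ω)]
      Function.uncurry v) : normQ l T Ω u = normQ l T Ω v := by
  have ht : ∀ᵐ t ∂(volume.restrict (Ioo 0 T)), u t =ᵐ[volume.restrict Ω] v t :=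
    Measure.ae_ae_of_ae_prod h
  have hx : ∀ᵐ x ∂(volume.restrict Ω),
      (fun t => u t x) =ᵐ[volume.restrict (Ioo 0 T)] fun t => v t x := ae_ae_swap h
  have h1 : parL2Sq T Ω u = parL2Sq T Ω v :=
    lintegral_congr_ae (ht.mono fun t ht => l2Sq_congr_ae ht)
  have h2 : parSq l T Ω u = parSq l T Ω v := by
    rw [parSq, parSq, lintegral_congr_ae (ht.mono fun t ht => slobSq_congr_ae l ht),
      lintegral_congr_ae (hx.mono fun x hx => slobSq_congr_ae (l / 2) hx)]
  rw [normQ, normQ, h1, h2]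

/-- The square of the constant in the product estimate, up to factors independent of `T`. -/
noncomputable def productConstSq (l p T : ℝ) : ℝ≥0∞ :=
  2 * ENNReal.ofReal T ^ ((p - 2) / 2) + ENNReal.ofReal T ^ ((p - 2) / 2 - l) + 4 +
    4 * (4 * kernelMass (2 + l - p / 2) T) ^ (2 / p)

/-- The weight `T^(-l)` is already absorbed: the condition on `p` makes `(p - 2) / 2 - l` positive,
so only nonnegative powers of `T` and of the kernel mass remain. -/
lemma productConstSq_mono {l p : ℝ} (hp : 2 < p) (hlp : 2 + 2 * l < p) :
    Monotone (productConstSq l p) := by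
  intro S T hST
  have h := ENNReal.ofReal_le_ofReal hST
  have hp0 : 0 < p := by linarith
  have hk := kernelMass_mono (2 + l - p / 2) hST
  have h1 := ENNReal.rpow_le_rpow h (by linarith : 0 ≤ (p - 2) / 2)
  have h2 := ENNReal.rpow_le_rpow h (by linarith : 0 ≤ (p - 2) / 2 - l)
  have h3 := ENNReal.rpow_le_rpow (mul_le_mul' (le_refl (4 : ℝ≥0∞)) hk)
    (by positivity : 0 ≤ 2 / p)
  unfold productConstSq
  gcongr

lemma productConstSq_ne_top {l p : ℝ} (hp : 2 < p) (hlp : 2 + 2 * l < p) (T : ℝ) :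
    productConstSq l p T ≠ ⊤ := by
  have hp0 : 0 < p := by linarith
  have h1 : ENNReal.ofReal T ^ ((p - 2) / 2) ≠ ⊤ :=
    ENNReal.rpow_ne_top_of_nonneg (by linarith) ENNReal.ofReal_ne_top
  have h2 : ENNReal.ofReal T ^ ((p - 2) / 2 - l) ≠ ⊤ :=
    ENNReal.rpow_ne_top_of_nonneg (by linarith) ENNReal.ofReal_ne_top
  have h3 : (4 * kernelMass (2 + l - p / 2) T) ^ (2 / p) ≠ ⊤ :=
    ENNReal.rpow_ne_top_of_nonneg (by positivity)
      (ENNReal.mul_ne_top (by simp) (kernelMass_ne_top (by linarith) T))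
  unfold productConstSq
  exact ENNReal.add_ne_top.2 ⟨ENNReal.add_ne_top.2 ⟨ENNReal.add_ne_top.2
    ⟨ENNReal.mul_ne_top (by simp) h1, h2⟩, by simp⟩, ENNReal.mul_ne_top (by simp) h3⟩

section

variable {E₁ E₂ E₃ : Type*} [NormedAddCommGroup E₁] [NormedSpace ℝ E₁]
  [NormedAddCommGroup E₂] [NormedSpace ℝ E₂] [NormedAddCommGroup E₃] [NormedSpace ℝ E₃]
variable {l p T : ℝ} {Ω : Set R3} {f : ℝ → R3 → E₁} {g : ℝ → R3 → E₂} {M₁ M₂ : ℝ → ℝ≥0∞}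
  {K₁ K₂ : ℝ≥0∞}

lemma normQ_mul_le (mul : E₁ →L[ℝ] E₂ →L[ℝ] E₃) (hf : ParabolicBound l p T Ω f M₁ K₁)
    (hg : ParabolicBound l p T Ω g M₂ K₂) (hp : 2 < p) (hp4 : p < 4) (hT : 0 < T) :
    normQ l T Ω (fun t x => mul (f t x) (g t x)) ≤
      (‖mul‖ₑ ^ 2 * productConstSq l p T * (K₁ * K₂)) ^ (1 / 2 : ℝ) := by
  set b : ℝ → R3 → E₃ := fun t x => mul (f t x) (g t x)
  have hb : StronglyMeasurable (Function.uncurry b) := stronglyMeasurable_bilinear mul hf hg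
  have hbt : Measurable fun t => l2Sq Ω (b t) := (hb.enorm.pow_const 2).lintegral_prod_right'
  have hbx : Measurable fun x => l2Sq (Ioo 0 T) (fun t => b t x) :=
    (hb.enorm.pow_const 2).lintegral_prod_left'
  have h1 := lintegral_l2Sq_mul_le mul hf hg hp hp4
  have h2 := lintegral_slobSeminormSq_mul_le mul hf hg
  have h3 := lintegral_slobSeminormSq_time_mul_le mul hf hg hp
  have h4 : ∫⁻ x in Ω, l2Sq (Ioo 0 T) (fun t => b t x) = ∫⁻ t in Ioo 0 T, l2Sq Ω (b t) :=
    (lintegral_lintegral_swap (hb.enorm.pow_const 2).aemeasurable).symm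
  have hS0 : ENNReal.ofReal T ≠ 0 := by simpa using hT
  have hTl : ENNReal.ofReal (T ^ (-l)) * ENNReal.ofReal T ^ ((p - 2) / 2) =
      ENNReal.ofReal T ^ ((p - 2) / 2 - l) := by
    rw [← ENNReal.ofReal_rpow_of_pos hT, ← ENNReal.rpow_add _ _ hS0 ENNReal.ofReal_ne_top]
    ring_nf
  rw [normQ]
  refine ENNReal.rpow_le_rpow ?_ (by norm_num)
  simp only [parSq, parL2Sq, slobSq]
  rw [lintegral_add_left hbt, lintegral_add_left hbx, h4]
  refine (add_le_add (add_le_add (add_le_add h1 h2) (add_le_add h1 h3))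
    (mul_le_mul' le_rfl h1)).trans_eq ?_
  rw [productConstSq, ← hTl]
  ring

end

theorem proposition5p1
    {E₁ E₂ E₃ : Type*}
    [NormedAddCommGroup E₁] [NormedSpace ℝ E₁] [FiniteDimensional ℝ E₁]
    [NormedAddCommGroup E₂] [NormedSpace ℝ E₂] [FiniteDimensional ℝ E₂]
    [NormedAddCommGroup E₃] [NormedSpace ℝ E₃] [FiniteDimensional ℝ E₃]
    (mul : E₁ →L[ℝ] E₂ →L[ℝ] E₃)
    (l : ℝ) (hl₀ : 1 / 2 < l) (hl₁ : l < 1)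
    (h : EuclideanSpace ℝ (Fin 2) → ℝ) (hh : ∃ K : ℝ≥0, LipschitzWith K h) :
    ∃ C₅₁ : ℝ → ℝ≥0, MonotoneOn C₅₁ (Set.Ioi 0) ∧
      ∀ T : ℝ, 0 < T → ∀ (F : ℝ → R3 → E₁) (G : ℝ → R3 → E₂),
        MemH l T (fluidDomain h) F → MemH l T (fluidDomain h) G →
          normQ l T (fluidDomain h) (fun t x => mul (F t x) (G t x)) ≤
            C₅₁ T * normH l T (fluidDomain h) F * normH l T (fluidDomain h) G := by
  obtain ⟨K, hK⟩ := hh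
  have hΩm : MeasurableSet (fluidDomain h) := (isOpen_fluidDomain hK.continuous).measurableSet
  have hΩ := containsCone_fluidDomain hK
  have := FiniteDimensional.complete ℝ E₁
  have := FiniteDimensional.complete ℝ E₂
  have h3l : 0 < 3 - 2 * l := by linarith
  -- The lower bound serves the time kernel and the weight `T^(-l)`, the bound `4` the `L⁴`
  -- interpolation, and `6 / (3 - 2 * l)` is the critical Sobolev exponent of `W₂^l`. The interval
  -- is nonempty because `l < 1` and because `(2 + 2l)(3 - 2l) = 6 + 2l(1 - 2l) < 6` for `l > 1/2`.
  obtain ⟨p, hlp, hpmin⟩ : ∃ p, 2 + 2 * l < p ∧ p < min 4 (6 / (3 - 2 * l)) := by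
    refine exists_between (lt_min (by linarith) ?_)
    rw [lt_div_iff₀ h3l]
    nlinarith
  have hp4 : p < 4 := hpmin.trans_le (min_le_left _ _)
  have hp : 2 < p := by linarith
  have hpl : 3 / 2 - 3 / p ≤ l := by
    have h6 := hpmin.trans_le (min_le_right _ _)
    rw [lt_div_iff₀ h3l] at h6
    have : (3 / 2 - l) ≤ 3 / p := by
      rw [le_div_iff₀ (by linarith)]
      linarith
    linarith
  obtain ⟨C₁, hC₁⟩ := exists_parabolicBound (E := E₁) hΩm hΩ hl₀ hp hpl
  obtain ⟨C₂, hC₂⟩ := exists_parabolicBound (E := E₂) hΩm hΩ hl₀ hp hpl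
  set D : ℝ → ℝ≥0∞ := fun T => (‖mul‖ₑ ^ 2 * productConstSq l p T * (C₁ * C₂)) ^ (1 / 2 : ℝ)
  have hD : ∀ T, D T ≠ ⊤ := fun T => ENNReal.rpow_ne_top_of_nonneg (by norm_num)
    (ENNReal.mul_ne_top (ENNReal.mul_ne_top (by simp) (productConstSq_ne_top hp hlp T))
      (ENNReal.mul_ne_top ENNReal.coe_ne_top ENNReal.coe_ne_top))
  refine ⟨fun T => (D T).toNNReal, fun S _ T _ hST => ?_, fun T hT F G hF hG => ?_⟩
  · refine ENNReal.toNNReal_mono (hD T) (ENNReal.rpow_le_rpow ?_ (by norm_num))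
    exact mul_le_mul' (mul_le_mul' le_rfl (productConstSq_mono hp hlp hST)) le_rfl
  obtain ⟨f, M₁, hFf, hf⟩ := hC₁ T F hF
  obtain ⟨g, M₂, hGg, hg⟩ := hC₂ T G hG
  have hcongr : normQ l T (fluidDomain h) (fun t x => mul (F t x) (G t x)) =
      normQ l T (fluidDomain h) (fun t x => mul (f t x) (g t x)) := by
    refine normQ_congr_ae l T _ ?_
    filter_upwards [hFf, hGg] with z h1 h2
    simp only [Function.uncurry] at h1 h2 ⊢
    rw [h1, h2]
  rw [hcongr, ENNReal.coe_toNNReal (hD T)]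
  refine (normQ_mul_le mul hf hg hp hp4 hT).trans_eq ?_
  have hsq : ∀ a : ℝ≥0∞, (a ^ 2) ^ (1 / 2 : ℝ) = a := fun a => by
    rw [← ENNReal.rpow_natCast, ← ENNReal.rpow_mul]; norm_num
  set a := normH l T (fluidDomain h) F
  set b := normH l T (fluidDomain h) G
  calc _ = (‖mul‖ₑ ^ 2 * productConstSq l p T * (C₁ * C₂) * (a * b) ^ 2) ^ (1 / 2 : ℝ) := by
        congr 1; ring
    _ = D T * (a * b) := by rw [ENNReal.mul_rpow_of_nonneg _ _ (by norm_num), hsq]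
    _ = _ := by ring
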